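/- Let $H$ be a separable complex Hilbert space and let $D$ be a self-adjoint operator in $H$, with domain $\mathcal D(D)$, that has compact resolvent. Let $\mathcal B^{sa}$ be the set of bounded self-adjoint operators on $H$ and $D+\mathcal B^{sa}=\{D+C : C\in\mathcal B^{sa}\}$. For $T_1=D+C_1$ and $T_2=D+C_2$ in $D+\mathcal B^{sa}$ put - $d_N(T_1,T_2)=\|C_1-C_2\|$ (norm metric), - $d_W(T_1,T_2)=\|(T_1-T_2)(I+D^2)^{-1/2}\|$, - $d_R(T_1,T_2)=\|F(T_1)-F(T_2)\|$, where $F(T)=T(I+T^2)^{-1/2}$ (Riesz metric), - $d_G(T_1,T_2)=\tfrac12\|\kappa(T_1)-\kappa(T_2)\|=\|(T_1+i)^{-1}-(T_2+i)^{-1}\|$, where $\kappa(T)=(T-i)(T+i)^{-1}$ (graph metric). 1. If $H$ is infinite-dimensional, then on $D+\mathcal B^{sa}$ the topology induced by $d_N$ is strictly stronger than the one induced by $d_W$, which is strictly stronger than the one induced by $d_R$, which is strictly stronger than the one induced by $d_G$. 2. For every fixed $R\ge 0$, the metrics $d_W$ and $d_R$ induce the same topology on the subset $$\{D+C : C\in\mathcal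 B^{sa},\ \| |D+i|^{-1}\,C\,|D+i| \|\le R\}\subset D+\mathcal B^{sa},$$ where $|D+i|=(I+D^2)^{1/2}$ and the condition means that $\| |D+i|^{-1}C|D+i|x\|\le R\|x\|$ for all $x\in\mathcal D(D)$. -/

import Mathlib

open scoped InnerProductSpace

namespace UnboundedOp

/-! ### Topologies induced by metrics -/

/-- The topology induced by a distance function `d`: a set is open iff with each of its points it
contains a `d`-ball of positive radius around that point. -/
@[reducible] def metricTopology {X : Type*} (d : X → X → ℝ) : TopologicalSpace X where
  IsOpen U := ∀ x ∈ U, ∃ ε > 0, ∀ y, d x y < ε → y ∈ U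
  isOpen_univ := fun _ _ => ⟨1, one_pos, fun _ _ => trivial⟩
  isOpen_inter := by
    intro U V hU hV x hx
    obtain ⟨ε, hε, h1⟩ := hU x hx.1
    obtain ⟨δ, hδ, h2⟩ := hV x hx.2
    exact ⟨min ε δ, lt_min hε hδ, fun y hy =>
      ⟨h1 y (hy.trans_le (min_le_left _ _)), h2 y (hy.trans_le (min_le_right _ _))⟩⟩
  isOpen_sUnion := by
    intro S hS x hx
    obtain ⟨U, hU, hxU⟩ := hx
    obtain ⟨ε, hε, h⟩ := hS U hU x hxU
    exact ⟨ε, hε, fun y hy => ⟨U, hU, h y hy⟩⟩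

/-- `d₁ ⪰ d₂`: the topology induced by `d₁` is stronger than (or equal to) the one induced by `d₂`,
that is, every `d₂`-open set is `d₁`-open. -/
def Stronger {X : Type*} (d₁ d₂ : X → X → ℝ) : Prop :=
  metricTopology d₁ ≤ metricTopology d₂

/-- The topology induced by `d₁` is strictly stronger than the one induced by `d₂`. -/
def StrictlyStronger {X : Type*} (d₁ d₂ : X → X → ℝ) : Prop :=
  metricTopology d₁ < metricTopology d₂

/-! ### Unbounded self-adjoint operators and their resolvents -/

variable {H : Type*} [NormedAddCommGroup H] [InnerProductSpace ℂ H] [CompleteSpace H]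

variable (H) in
/-- The set `𝒞ˢᵃ` of (densely defined, not necessarily bounded) self-adjoint operators in `H`. -/
abbrev SelfAdjointOp : Type _ := {T : H →ₗ.[ℂ] H // IsSelfAdjoint T}

variable (H) in
/-- The set `ℬˢᵃ` of bounded self-adjoint operators in `H`. -/
abbrev BoundedSelfAdjointOp : Type _ := {C : H →L[ℂ] H // IsSelfAdjoint C}

theorem inner_self_ofReal (x : H) : ⟪x, x⟫_ℂ = ((‖x‖ ^ 2 : ℝ) : ℂ) := by
  rw [inner_self_eq_norm_sq_to_K]
  push_cast
  rfl

theorem inner_symm (T : SelfAdjointOp H) (x y : T.1.domain) :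
    ⟪T.1 x, (y : H)⟫_ℂ = ⟪(x : H), T.1 y⟫_ℂ := by
  have h := LinearPMap.adjoint_isFormalAdjoint T.2.dense_domain
  rw [LinearPMap.isSelfAdjoint_def.mp T.2] at h
  exact h x y

theorem mem_graph_of_inner (T : SelfAdjointOp H) (v w : H)
    (h : ∀ x : T.1.domain, ⟪w, (x : H)⟫_ℂ = ⟪v, T.1 x⟫_ℂ) :
    ∃ hv : v ∈ T.1.domain, T.1 ⟨v, hv⟩ = w := by
  have hT := LinearPMap.isSelfAdjoint_def.mp T.2
  have hv := LinearPMap.mem_adjoint_domain_of_exists v ⟨w, h⟩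
  have hg : (v, w) ∈ T.1.graph := by
    rw [← hT, LinearPMap.mem_graph_iff]
    exact ⟨⟨v, hv⟩, rfl, LinearPMap.adjoint_apply_eq T.2.dense_domain ⟨v, hv⟩ h⟩
  rw [LinearPMap.mem_graph_iff] at hg
  obtain ⟨u, hu1, hu2⟩ := hg
  have hu1 : (u : H) = v := hu1
  subst hu1
  exact ⟨u.2, hu2⟩

/-- The operator `T + z`, as a linear map on the domain of `T`. -/
def addScalar (T : H →ₗ.[ℂ] H) (z : ℂ) : T.domain →ₗ[ℂ] H :=
  z • T.domain.subtype + T.toFun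

theorem addScalar_apply (T : H →ₗ.[ℂ] H) (z : ℂ) (x : T.domain) :
    addScalar T z x = z • (x : H) + T x := rfl

theorem norm_le_addScalar (T : SelfAdjointOp H) (z : ℂ) (x : T.1.domain) :
    |z.im| * ‖(x : H)‖ ≤ ‖addScalar T.1 z x‖ := by
  have h0 : (⟪(x : H), T.1 x⟫_ℂ).im = 0 := by
    have h1 := inner_symm T x x
    have h2 := inner_conj_symm (𝕜 := ℂ) (x : H) (T.1 x)
    rw [h1] at h2
    exact Complex.conj_eq_iff_im.mp h2
  have h3 : (⟪(x : H), addScalar T.1 z x⟫_ℂ).im = z.im * ‖(x : H)‖ ^ 2 := by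
    rw [addScalar_apply, inner_add_right, inner_smul_right, inner_self_ofReal,
      Complex.add_im, h0, add_zero, Complex.im_mul_ofReal]
  have h4 : |z.im| * ‖(x : H)‖ ^ 2 ≤ ‖(x : H)‖ * ‖addScalar T.1 z x‖ := by
    calc |z.im| * ‖(x : H)‖ ^ 2 = |(⟪(x : H), addScalar T.1 z x⟫_ℂ).im| := by
          rw [h3, abs_mul, abs_of_nonneg (sq_nonneg ‖(x : H)‖)]
      _ ≤ ‖⟪(x : H), addScalar T.1 z x⟫_ℂ‖ := Complex.abs_im_le_norm _
      _ ≤ _ := norm_inner_le_norm _ _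
  rcases (norm_nonneg (x : H)).eq_or_lt with hx | hx
  · rw [← hx, mul_zero]; exact norm_nonneg _
  · nlinarith

theorem addScalar_injective (T : SelfAdjointOp H) (z : ℂ) (hz : z.im ≠ 0) :
    Function.Injective (addScalar T.1 z) := by
  rw [injective_iff_map_eq_zero]
  intro x hx
  have h := norm_le_addScalar T z x
  rw [hx, norm_zero] at h
  have hz' : 0 < |z.im| := abs_pos.mpr hz
  have : ‖(x : H)‖ = 0 := le_antisymm (by nlinarith) (norm_nonneg _)
  exact Subtype.ext (norm_eq_zero.mp this)

theorem addScalar_surjective (T : SelfAdjointOp H) (z : ℂ) (hz : z.im ≠ 0) :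
    Function.Surjective (addScalar T.1 z) := by
  have hz' : 0 < |z.im| := abs_pos.mpr hz
  set V : Submodule ℂ H := LinearMap.range (addScalar T.1 z) with hV
  have hclosed : IsClosed (V : Set H) := by
    rw [← isSeqClosed_iff_isClosed]
    intro y y₀ hy hlim
    choose x hx using hy
    have hcau : CauchySeq fun n => (x n : H) := by
      rw [Metric.cauchySeq_iff]
      intro ε hε
      obtain ⟨N, hN⟩ := Metric.cauchySeq_iff.mp hlim.cauchySeq (|z.im| * ε) (mul_pos hz' hε)
      refine ⟨N, fun m hm n hn => ?_⟩
      have h1 := hN m hm n hn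
      have h2 := norm_le_addScalar T z (x m - x n)
      rw [map_sub, hx, hx, ← dist_eq_norm] at h2
      have h3 : ‖((x m - x n : T.1.domain) : H)‖ = dist (x m : H) (x n) := by
        rw [dist_eq_norm]; rfl
      rw [h3] at h2
      exact lt_of_mul_lt_mul_left (h2.trans_lt h1) hz'.le
    obtain ⟨x₀, hx₀⟩ := cauchySeq_tendsto_of_complete hcau
    have hT : Filter.Tendsto (fun n => T.1 (x n)) Filter.atTop (nhds (y₀ - z • x₀)) := by
      refine (hlim.sub (hx₀.const_smul z)).congr fun n => ?_
      rw [← hx n, addScalar_apply, add_sub_cancel_left]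
    have hg : (x₀, y₀ - z • x₀) ∈ T.1.graph :=
      T.2.isClosed.mem_of_tendsto (hx₀.prodMk_nhds hT)
        (Filter.Eventually.of_forall fun n => LinearPMap.mem_graph T.1 (x n))
    obtain ⟨u, hu1, hu2⟩ := (LinearPMap.mem_graph_iff _).mp hg
    have hu1 : (u : H) = x₀ := hu1
    have hu2 : T.1 u = y₀ - z • x₀ := hu2
    refine ⟨u, ?_⟩
    rw [addScalar_apply, hu1, hu2, add_sub_cancel]
  have horth : Vᗮ = ⊥ := by
    rw [Submodule.eq_bot_iff]
    intro v hv
    have hv' : ∀ x : T.1.domain, ⟪v, z • (x : H) + T.1 x⟫_ℂ = 0 := fun x =>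
      (Submodule.mem_orthogonal' V v).mp hv _ ⟨x, rfl⟩
    obtain ⟨hvd, -⟩ := mem_graph_of_inner T v (-((starRingEnd ℂ) z • v)) (by
      intro x
      have := hv' x
      rw [inner_add_right, inner_smul_right] at this
      rw [inner_neg_left, inner_smul_left, Complex.conj_conj]
      linear_combination (-1 : ℂ) * this)
    have h0 : (⟪v, T.1 ⟨v, hvd⟩⟫_ℂ).im = 0 := by
      have h1 := inner_symm T ⟨v, hvd⟩ ⟨v, hvd⟩
      have h2 := inner_conj_symm (𝕜 := ℂ) v (T.1 ⟨v, hvd⟩)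
      rw [h1] at h2
      exact Complex.conj_eq_iff_im.mp h2
    have h5 := congrArg Complex.im (hv' ⟨v, hvd⟩)
    rw [inner_add_right, inner_smul_right, inner_self_ofReal, Complex.add_im, h0,
      add_zero, Complex.im_mul_ofReal] at h5
    have h6 : z.im * ‖v‖ ^ 2 = 0 := h5
    have h7 : ‖v‖ = 0 := by
      rcases mul_eq_zero.mp h6 with h | h
      · exact absurd h hz
      · exact pow_eq_zero_iff (two_ne_zero) |>.mp h
    exact norm_eq_zero.mp h7
  have : CompleteSpace V := hclosed.completeSpace_coe
  have htop : V = ⊤ := (Submodule.orthogonal_eq_bot_iff).mp horth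
  exact LinearMap.range_eq_top.mp htop

/-- The bounded operator `(T + z)⁻¹`, for `T` self-adjoint and `z` not real. -/
noncomputable def resolventOp (T : SelfAdjointOp H) (z : ℂ) (hz : z.im ≠ 0) : H →L[ℂ] H :=
  LinearMap.mkContinuous
    (T.1.domain.subtype ∘ₗ (LinearEquiv.ofBijective (addScalar T.1 z)
      ⟨addScalar_injective T z hz, addScalar_surjective T z hz⟩).symm.toLinearMap)
    |z.im|⁻¹ (by
      intro y
      obtain ⟨x, rfl⟩ := addScalar_surjective T z hz y
      have h := norm_le_addScalar T z x
      have hz' : 0 < |z.im| := abs_pos.mpr hz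
      have h2 : (LinearEquiv.ofBijective (addScalar T.1 z)
        ⟨addScalar_injective T z hz, addScalar_surjective T z hz⟩).symm
          (addScalar T.1 z x) = x := LinearEquiv.ofBijective_symm_apply_apply _ x
      rw [LinearMap.comp_apply, LinearEquiv.coe_coe, h2]
      rw [inv_mul_eq_div, le_div_iff₀ hz', mul_comm]
      exact h)

theorem resolventOp_apply (T : SelfAdjointOp H) (z : ℂ) (hz : z.im ≠ 0) (x : T.1.domain) :
    resolventOp T z hz (z • (x : H) + T.1 x) = x :=
  congrArg Subtype.val (LinearEquiv.ofBijective_symm_apply_apply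
    (addScalar T.1 z) (h := ⟨addScalar_injective T z hz, addScalar_surjective T z hz⟩) x)

theorem resolventOp_spec (T : SelfAdjointOp H) (z : ℂ) (hz : z.im ≠ 0) (y : H) :
    ∃ h : resolventOp T z hz y ∈ T.1.domain,
      z • resolventOp T z hz y + T.1 ⟨resolventOp T z hz y, h⟩ = y := by
  obtain ⟨x, rfl⟩ := addScalar_surjective T z hz y
  have h := resolventOp_apply T z hz x
  rw [← addScalar_apply] at h
  refine ⟨by rw [h]; exact x.2, ?_⟩
  have h2 : (⟨resolventOp T z hz (addScalar T.1 z x), by rw [h]; exact x.2⟩ :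
      T.1.domain) = x := Subtype.ext h
  rw [h2, h, addScalar_apply]

theorem I_im_ne : Complex.I.im ≠ 0 := by simp

theorem neg_I_im_ne : (-Complex.I).im ≠ 0 := by simp

/-- `D` has compact resolvent: `(D + i)⁻¹` is a compact operator. -/
def HasCompactResolvent (D : SelfAdjointOp H) : Prop :=
  IsCompactOperator (resolventOp D Complex.I I_im_ne)

/-! ### The bounded operators `(I + T²)⁻¹` and `(I + T²)^(-1/2)` -/

/-- `(I + T²)⁻¹ = (T + i)⁻¹ (T - i)⁻¹`. -/
noncomputable def invOneAddSq (T : SelfAdjointOp H) : H →L[ℂ] H :=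
  resolventOp T Complex.I I_im_ne ∘L resolventOp T (-Complex.I) neg_I_im_ne

/-- `A = (I + T²)⁻¹` maps `H` into the domain of `T²`, and `A x + T² A x = x`. -/
theorem invOneAddSq_spec (T : SelfAdjointOp H) (x : H) :
    ∃ (h : invOneAddSq T x ∈ T.1.domain) (h' : T.1 ⟨invOneAddSq T x, h⟩ ∈ T.1.domain),
      invOneAddSq T x + T.1 ⟨T.1 ⟨invOneAddSq T x, h⟩, h'⟩ = x := by
  obtain ⟨h1, e1⟩ := resolventOp_spec T (-Complex.I) neg_I_im_ne x
  set u := resolventOp T (-Complex.I) neg_I_im_ne x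
  obtain ⟨h2, e2⟩ := resolventOp_spec T Complex.I I_im_ne u
  have hv : invOneAddSq T x = resolventOp T Complex.I I_im_ne u := rfl
  simp only [hv]
  set v := resolventOp T Complex.I I_im_ne u
  have hTv : T.1 ⟨v, h2⟩ = u - Complex.I • v := by rw [← e2, add_sub_cancel_left]
  have hmem : u - Complex.I • v ∈ T.1.domain := T.1.domain.sub_mem h1 (T.1.domain.smul_mem _ h2)
  refine ⟨h2, hTv ▸ hmem, ?_⟩
  have h3 : (⟨T.1 ⟨v, h2⟩, hTv ▸ hmem⟩ : T.1.domain) =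
      ⟨u, h1⟩ - Complex.I • ⟨v, h2⟩ := Subtype.ext hTv
  rw [h3, LinearPMap.map_sub, LinearPMap.map_smul, hTv, smul_sub, smul_smul, Complex.I_mul_I]
  rw [← sub_eq_zero, ← sub_eq_zero.mpr e1]
  module

theorem inner_invOneAddSq (T : SelfAdjointOp H) (x : H) :
    ⟪invOneAddSq T x, x⟫_ℂ = ((‖resolventOp T (-Complex.I) neg_I_im_ne x‖ ^ 2 : ℝ) : ℂ) := by
  obtain ⟨h1, e1⟩ := resolventOp_spec T (-Complex.I) neg_I_im_ne x
  have hv : invOneAddSq T x = resolventOp T Complex.I I_im_ne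
    (resolventOp T (-Complex.I) neg_I_im_ne x) := rfl
  rw [hv]
  set u := resolventOp T (-Complex.I) neg_I_im_ne x with hu
  have e1' : -Complex.I • u + T.1 ⟨u, h1⟩ = x := e1
  clear_value u
  obtain ⟨h2, e2⟩ := resolventOp_spec T Complex.I I_im_ne u
  set v := resolventOp T Complex.I I_im_ne u
  have h3 := inner_symm T ⟨v, h2⟩ ⟨u, h1⟩
  have h4 : ⟪u, u⟫_ℂ = ⟪v, x⟫_ℂ := by
    nth_rw 1 [← e2]
    rw [inner_add_left, inner_smul_left, h3, ← e1', inner_add_right, inner_smul_right,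
      Complex.conj_I]
  rw [← h4, inner_self_ofReal]

theorem invOneAddSq_nonneg (T : SelfAdjointOp H) : 0 ≤ invOneAddSq T := by
  rw [ContinuousLinearMap.nonneg_iff_isPositive, ContinuousLinearMap.isPositive_iff_complex]
  intro x
  rw [inner_invOneAddSq]
  refine ⟨?_, ?_⟩
  · rw [RCLike.re_eq_complex_re, Complex.ofReal_re]
  · rw [RCLike.re_eq_complex_re, Complex.ofReal_re]; positivity

/-- `(I + T²)^(-1/2)`, the positive square root of `(I + T²)⁻¹`; it is also `|T + i|⁻¹`. -/
noncomputable def invSqrt (T : SelfAdjointOp H) : H →L[ℂ] H := CFC.sqrt (invOneAddSq T)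

theorem invSqrt_sq (T : SelfAdjointOp H) (x : H) : invSqrt T (invSqrt T x) = invOneAddSq T x :=
  congrArg (fun A : H →L[ℂ] H => A x) (CFC.sqrt_mul_sqrt_self _ (invOneAddSq_nonneg T))

theorem inner_invSqrt (T : SelfAdjointOp H) (x y : H) :
    ⟪invSqrt T x, y⟫_ℂ = ⟪x, invSqrt T y⟫_ℂ :=
  ((ContinuousLinearMap.nonneg_iff_isPositive _).mp
    (CFC.sqrt_nonneg (invOneAddSq T))).isSymmetric x y

theorem invSqrt_injective (T : SelfAdjointOp H) : Function.Injective (invSqrt T) := by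
  rw [injective_iff_map_eq_zero]
  intro x hx
  obtain ⟨h, h', e⟩ := invOneAddSq_spec T x
  have h0 : invOneAddSq T x = 0 := by rw [← invSqrt_sq, hx, map_zero]
  have h1 : (⟨invOneAddSq T x, h⟩ : T.1.domain) = 0 := Subtype.ext h0
  have h2 : T.1 ⟨invOneAddSq T x, h⟩ = 0 := by rw [h1, LinearPMap.map_zero]
  have h3 : (⟨T.1 ⟨invOneAddSq T x, h⟩, h'⟩ : T.1.domain) = 0 := Subtype.ext h2
  rw [h3, LinearPMap.map_zero, h0, add_zero] at e
  exact e.symm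

theorem invSqrt_denseRange (T : SelfAdjointOp H) : DenseRange (invSqrt T) := by
  have h : (LinearMap.range (invSqrt T).toLinearMap)ᗮ = ⊥ := by
    rw [Submodule.eq_bot_iff]
    intro v hv
    apply invSqrt_injective T
    rw [map_zero]
    refine ext_inner_right ℂ fun w => ?_
    rw [inner_invSqrt, inner_zero_left]
    exact (Submodule.mem_orthogonal' _ v).mp hv _ ⟨w, rfl⟩
  have h2 := Submodule.topologicalClosure_eq_top_iff.mpr h
  have h3 := Submodule.dense_iff_topologicalClosure_eq_top.mpr h2
  exact h3

theorem norm_mul_invOneAddSq_le (T : SelfAdjointOp H) (z : H)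
    (h : invOneAddSq T z ∈ T.1.domain) : ‖T.1 ⟨invOneAddSq T z, h⟩‖ ≤ ‖invSqrt T z‖ := by
  obtain ⟨_, h', e⟩ : ∃ (h : invOneAddSq T z ∈ T.1.domain)
      (h' : T.1 ⟨invOneAddSq T z, h⟩ ∈ T.1.domain),
      invOneAddSq T z + T.1 ⟨T.1 ⟨invOneAddSq T z, h⟩, h'⟩ = z := invOneAddSq_spec T z
  have h1 := inner_symm T ⟨invOneAddSq T z, h⟩ ⟨T.1 ⟨invOneAddSq T z, h⟩, h'⟩
  have h2 : T.1 ⟨T.1 ⟨invOneAddSq T z, h⟩, h'⟩ = z - invOneAddSq T z :=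
    eq_sub_of_add_eq' e
  have h3 : ⟪invOneAddSq T z, z⟫_ℂ = ((‖invSqrt T z‖ ^ 2 : ℝ) : ℂ) := by
    rw [← invSqrt_sq, inner_invSqrt, inner_self_ofReal]
  rw [h2, inner_sub_right, h3, inner_self_ofReal, inner_self_ofReal] at h1
  have h4 : ‖T.1 ⟨invOneAddSq T z, h⟩‖ ^ 2 = ‖invSqrt T z‖ ^ 2 - ‖invOneAddSq T z‖ ^ 2 := by
    exact_mod_cast h1
  refine le_of_sq_le_sq ?_ (norm_nonneg _)
  rw [h4]
  linarith [sq_nonneg ‖invOneAddSq T z‖]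

/-- `(I + T²)^(-1/2)` maps `H` into the domain of `T`. -/
theorem invSqrt_mem (T : SelfAdjointOp H) (x : H) : invSqrt T x ∈ T.1.domain := by
  obtain ⟨y, hy, hlim⟩ := mem_closure_iff_seq_limit.mp (invSqrt_denseRange T x)
  choose z hz using hy
  have hmem : ∀ n, invSqrt T (y n) ∈ T.1.domain := fun n => by
    rw [← hz n, invSqrt_sq]; exact (invOneAddSq_spec T (z n)).1
  have hbound : ∀ m n, ‖T.1 ⟨invSqrt T (y m), hmem m⟩ - T.1 ⟨invSqrt T (y n), hmem n⟩‖
      ≤ ‖y m - y n‖ := by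
    intro m n
    have e : invSqrt T (y m) - invSqrt T (y n) = invOneAddSq T (z m - z n) := by
      rw [← hz m, ← hz n, invSqrt_sq, invSqrt_sq, map_sub]
    have e' : y m - y n = invSqrt T (z m - z n) := by rw [map_sub, hz, hz]
    have hd : invOneAddSq T (z m - z n) ∈ T.1.domain := (invOneAddSq_spec T _).1
    have e2 : (⟨invSqrt T (y m), hmem m⟩ - ⟨invSqrt T (y n), hmem n⟩ : T.1.domain) =
        ⟨invOneAddSq T (z m - z n), hd⟩ := Subtype.ext e
    rw [← LinearPMap.map_sub, e2, e']
    exact norm_mul_invOneAddSq_le T _ hd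
  have hcau : CauchySeq fun n => T.1 ⟨invSqrt T (y n), hmem n⟩ := by
    rw [Metric.cauchySeq_iff]
    intro ε hε
    obtain ⟨N, hN⟩ := Metric.cauchySeq_iff.mp hlim.cauchySeq ε hε
    refine ⟨N, fun m hm n hn => ?_⟩
    rw [dist_eq_norm]
    exact (hbound m n).trans_lt (by rw [← dist_eq_norm]; exact hN m hm n hn)
  obtain ⟨w, hw⟩ := cauchySeq_tendsto_of_complete hcau
  have hg : (invSqrt T x, w) ∈ T.1.graph :=
    T.2.isClosed.mem_of_tendsto ((((invSqrt T).continuous.tendsto x).comp hlim).prodMk_nhds hw)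
      (Filter.Eventually.of_forall fun n => LinearPMap.mem_graph T.1 ⟨_, hmem n⟩)
  exact LinearPMap.mem_domain_of_mem_graph hg

/-! ### The Riesz metric and the graph metric on `𝒞ˢᵃ` -/

/-- If `T` is self-adjoint and the bounded operator `A` maps `H` into the domain of `T`, then the
product `T A` is an everywhere defined bounded operator (closed graph theorem). -/
noncomputable def mulBounded (T : SelfAdjointOp H) (A : H →L[ℂ] H)
    (h : ∀ x, A x ∈ T.1.domain) : H →L[ℂ] H :=
  ContinuousLinearMap.ofSeqClosedGraph
    (g := T.1.toFun ∘ₗ LinearMap.codRestrict T.1.domain A.toLinearMap h) (by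
      intro u x y hu hy
      have hg : (A x, y) ∈ T.1.graph :=
        T.2.isClosed.mem_of_tendsto (((A.continuous.tendsto x).comp hu).prodMk_nhds hy)
          (Filter.Eventually.of_forall fun n => LinearPMap.mem_graph T.1 ⟨A (u n), h (u n)⟩)
      obtain ⟨v, hv1, hv2⟩ := (LinearPMap.mem_graph_iff _).mp hg
      have hv : v = ⟨A x, h x⟩ := Subtype.ext hv1
      rw [hv] at hv2
      exact hv2.symm)

theorem mulBounded_apply (T : SelfAdjointOp H) (A : H →L[ℂ] H) (h : ∀ x, A x ∈ T.1.domain)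
    (x : H) : mulBounded T A h x = T.1 ⟨A x, h x⟩ := rfl

/-- The Riesz map `F(T) = T (I + T²)^(-1/2)`. -/
noncomputable def rieszMap (T : SelfAdjointOp H) : H →L[ℂ] H :=
  mulBounded T (invSqrt T) (invSqrt_mem T)

/-- The Riesz metric `d_R(T₁, T₂) = ‖F(T₁) - F(T₂)‖`. -/
noncomputable def distR (T₁ T₂ : SelfAdjointOp H) : ℝ := ‖rieszMap T₁ - rieszMap T₂‖

/-- The Cayley transform `κ(T) = (T - i) (T + i)⁻¹`. -/
noncomputable def cayley (T : SelfAdjointOp H) : H →L[ℂ] H :=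
  mulBounded T (resolventOp T Complex.I I_im_ne) (fun x => (resolventOp_spec T _ _ x).1)
    - Complex.I • resolventOp T Complex.I I_im_ne

/-- The graph metric `d_G(T₁, T₂) = ½ ‖κ(T₁) - κ(T₂)‖`. -/
noncomputable def distG (T₁ T₂ : SelfAdjointOp H) : ℝ := (1 / 2) * ‖cayley T₁ - cayley T₂‖

/-- `d_G(T₁, T₂) = ‖(T₁ + i)⁻¹ - (T₂ + i)⁻¹‖`. -/
theorem distG_eq (T₁ T₂ : SelfAdjointOp H) :
    distG T₁ T₂ = ‖resolventOp T₁ Complex.I I_im_ne - resolventOp T₂ Complex.I I_im_ne‖ := by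
  have key : ∀ T : SelfAdjointOp H, cayley T =
      ContinuousLinearMap.id ℂ H - (2 * Complex.I) • resolventOp T Complex.I I_im_ne := by
    intro T
    ext x
    obtain ⟨h, e⟩ := resolventOp_spec T Complex.I I_im_ne x
    have e1 : cayley T x = T.1 ⟨resolventOp T Complex.I I_im_ne x, h⟩
      - Complex.I • resolventOp T Complex.I I_im_ne x := rfl
    have e2 : T.1 ⟨resolventOp T Complex.I I_im_ne x, h⟩ =
      x - Complex.I • resolventOp T Complex.I I_im_ne x := eq_sub_of_add_eq' e
    have e3 : (ContinuousLinearMap.id ℂ H - (2 * Complex.I) • resolventOp T Complex.I I_im_ne) x =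
      x - (2 * Complex.I) • resolventOp T Complex.I I_im_ne x := rfl
    rw [e1, e2, e3]
    module
  have h2 : cayley T₁ - cayley T₂ = (-(2 * Complex.I)) •
      (resolventOp T₁ Complex.I I_im_ne - resolventOp T₂ Complex.I I_im_ne) := by
    rw [key, key]
    module
  rw [distG, h2, norm_smul]
  simp

/-! ### Operators with a fixed domain, and bounded perturbations -/

/-- `ℬˢᵃ(W, H)`: the self-adjoint operators whose domain is the domain `W` of `D`. -/
abbrev FixedDomainOp (D : SelfAdjointOp H) : Type _ :=
  {T : SelfAdjointOp H // T.1.domain = D.1.domain}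

/-- For `T` with the same domain as `D`, the bounded operator `T (I + D²)^(-1/2)`. -/
noncomputable def relBounded (D : SelfAdjointOp H) (T : FixedDomainOp D) : H →L[ℂ] H :=
  mulBounded T.1 (invSqrt D) (fun x => by rw [T.2]; exact invSqrt_mem D x)

/-- The metric `d_W(T₁, T₂) = ‖(T₁ - T₂) (I + D²)^(-1/2)‖` on `ℬˢᵃ(W, H)`. -/
noncomputable def distFixedDomain (D : SelfAdjointOp H) (T₁ T₂ : FixedDomainOp D) : ℝ :=
  ‖relBounded D T₁ - relBounded D T₂‖

/-- The self-adjoint operator `D + C`, with domain `𝒟(D)`, for `D` self-adjoint and `C` bounded and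
self-adjoint. -/
def addBounded (D : SelfAdjointOp H) (C : BoundedSelfAdjointOp H) : SelfAdjointOp H :=
  ⟨(C.1 : H →ₗ[ℂ] H) +ᵥ D.1, by
    have hC : ∀ x y : H, ⟪C.1 x, y⟫_ℂ = ⟪x, C.1 y⟫_ℂ := fun x y => by
      have h := ContinuousLinearMap.adjoint_inner_left C.1 y x
      rwa [ContinuousLinearMap.isSelfAdjoint_iff'.mp C.2] at h
    set S : H →ₗ.[ℂ] H := (C.1 : H →ₗ[ℂ] H) +ᵥ D.1 with hS
    have hdense : Dense (S.domain : Set H) := D.2.dense_domain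
    have hle : S ≤ S.adjoint := by
      apply LinearPMap.IsFormalAdjoint.le_adjoint hdense
      intro x y
      have h1 := inner_symm D x y
      have e1 : S x = C.1 (x : H) + D.1 x := rfl
      have e2 : S y = C.1 (y : H) + D.1 y := rfl
      rw [e1, e2, inner_add_left, inner_add_right, hC, h1]
    rw [LinearPMap.isSelfAdjoint_def]
    refine (LinearPMap.eq_of_le_of_domain_eq hle (le_antisymm hle.1 ?_)).symm
    intro y hy
    have hf := LinearPMap.adjoint_isFormalAdjoint hdense
    refine (mem_graph_of_inner D y (S.adjoint ⟨y, hy⟩ - C.1 y) fun x => ?_).1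
    have h1 := hf ⟨y, hy⟩ x
    have e1 : S x = C.1 (x : H) + D.1 x := rfl
    rw [e1, inner_add_right] at h1
    rw [inner_sub_left, h1, hC]
    ring⟩

theorem addBounded_injective (D : SelfAdjointOp H) : Function.Injective (addBounded D) := by
  intro C₁ C₂ h
  have h1 : (C₁.1 : H →ₗ[ℂ] H) +ᵥ D.1 = (C₂.1 : H →ₗ[ℂ] H) +ᵥ D.1 := congrArg Subtype.val h
  apply Subtype.ext
  apply ContinuousLinearMap.coeFn_injective
  refine Continuous.ext_on D.2.dense_domain C₁.1.continuous C₂.1.continuous fun x hx => ?_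
  have h2 : C₁.1 x + D.1 ⟨x, hx⟩ = C₂.1 x + D.1 ⟨x, hx⟩ :=
    (LinearPMap.ext_iff.mp h1).2 (hf := hx) (hg := hx)
  exact add_right_cancel h2

/-! The set `D + ℬˢᵃ` is parametrized by `ℬˢᵃ` through the bijection `C ↦ D + C`. The four distances
below are the distances of the operators `D + C₁` and `D + C₂`. -/

/-- `d_N(D + C₁, D + C₂) = ‖C₁ - C₂‖`. -/
noncomputable def dN (_D : SelfAdjointOp H) (C₁ C₂ : BoundedSelfAdjointOp H) : ℝ := ‖C₁.1 - C₂.1‖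

/-- `d_W(D + C₁, D + C₂)`. -/
noncomputable def dW (D : SelfAdjointOp H) (C₁ C₂ : BoundedSelfAdjointOp H) : ℝ :=
  distFixedDomain D ⟨addBounded D C₁, rfl⟩ ⟨addBounded D C₂, rfl⟩

/-- `d_R(D + C₁, D + C₂)`. -/
noncomputable def dR (D : SelfAdjointOp H) (C₁ C₂ : BoundedSelfAdjointOp H) : ℝ :=
  distR (addBounded D C₁) (addBounded D C₂)

/-- `d_G(D + C₁, D + C₂)`. -/
noncomputable def dG (D : SelfAdjointOp H) (C₁ C₂ : BoundedSelfAdjointOp H) : ℝ :=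
  distG (addBounded D C₁) (addBounded D C₂)

/-- The unbounded operator `|D + i| = (I + D²)^(1/2)`, the inverse of `(I + D²)^(-1/2)`. -/
noncomputable def absAddI (D : SelfAdjointOp H) : H →ₗ.[ℂ] H :=
  ((invSqrt D).toLinearMap.toPMap ⊤).inverse

theorem absAddI_invSqrt (D : SelfAdjointOp H) (x : H) :
    ∃ h : invSqrt D x ∈ (absAddI D).domain, absAddI D ⟨invSqrt D x, h⟩ = x := by
  have hinj : ((invSqrt D).toLinearMap.toPMap ⊤).toFun.ker = ⊥ := by
    rw [LinearMap.ker_eq_bot]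
    intro u v huv
    exact Subtype.ext (invSqrt_injective D huv)
  have hmem : invSqrt D x ∈ (absAddI D).domain := by
    rw [absAddI, LinearPMap.inverse_domain]
    exact ⟨⟨x, trivial⟩, rfl⟩
  exact ⟨hmem, LinearPMap.inverse_apply_eq hinj (y := ⟨invSqrt D x, hmem⟩)
    (x := ⟨x, trivial⟩) rfl⟩

/-- The operator `|D + i|⁻¹ C |D + i|`, defined on the domain of `|D + i|`. -/
noncomputable def conjByAbs (D : SelfAdjointOp H) (C : BoundedSelfAdjointOp H) : H →ₗ.[ℂ] H :=
  ((invSqrt D ∘L C.1).toLinearMap).compPMap (absAddI D)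

/-- `‖ |D + i|⁻¹ C |D + i| ‖ ≤ R`: the operator `|D + i|⁻¹ C |D + i|` is bounded on its domain, with
bound `R`. -/
def ConjNormLE (D : SelfAdjointOp H) (R : ℝ) (C : BoundedSelfAdjointOp H) : Prop :=
  ∀ x : (conjByAbs D C).domain, ‖conjByAbs D C x‖ ≤ R * ‖(x : H)‖

/-- The parameter set of `{D + C : C ∈ ℬˢᵃ, ‖ |D + i|⁻¹ C |D + i| ‖ ≤ R}`. -/
abbrev ConjBounded (D : SelfAdjointOp H) (R : ℝ) : Type _ :=
  {C : BoundedSelfAdjointOp H // ConjNormLE D R C}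

end UnboundedOp

open UnboundedOp

namespace UnboundedOp

variable {H : Type*} [NormedAddCommGroup H] [InnerProductSpace ℂ H] [CompleteSpace H]

section

/-! ### The bounded transform of a self-adjoint operator -/

/-! Put S = (I + T²)^(-1/2) and F = TS. These bounded operators commute, satisfy S² + F² = 1, and
parametrize the graph of T as {(Sx, Fx)}; every estimate below is made with them.

That d_N dominates d_W is just ‖S‖ ≤ 1. The hard comparison is d_W over d_R. For T₂ = T₁ + B, the
difference G = F₂ - F₁ solves a Sylvester equation S₂G + GS₁ = S₂^(1/2) J S₁^(1/2) with ‖J‖ ≤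
3‖S₂^(1/2) B S₁^(1/2)‖. Testing on singular vectors, which compactness provides, and applying the
arithmetic-geometric mean inequality gives ‖G‖ ≤ ‖J‖/2 (`norm_le_of_sylvester`). Interpolation
(`norm_mul_mul_sq_le`) then yields ‖G‖ ≤ 3‖BS₁‖ once ‖BS₁‖ ≤ 1/2. Finally d_R dominates d_G because
(T + i)⁻¹ = F(1 - F²)^(1/2) - i(1 - F²) is norm continuous in F.

Strictness uses unit eigenvectors f of D with eigenvalue l, |l| large, so that Sf is small. The
rank-one projection onto f has norm 1 but is small for d_W. Coupling a fixed vector e to f by a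
symmetric rank-two operator stays large for d_W but is small for d_R. Flipping l to -l moves F by
about 2 but barely moves the resolvent.

On the set with parameter R, even d_G controls d_W. The resolvent identity bounds SBS by d_G, and SB
is recovered from SBS through (S + η)⁻¹, the error being at most 2Rη (`dW_le_of_conjNormLE`). -/

theorem invSqrt_rieszMap_mem_graph (T : SelfAdjointOp H) (x : H) :
    (invSqrt T x, rieszMap T x) ∈ T.1.graph :=
  LinearPMap.mem_graph T.1 ⟨invSqrt T x, invSqrt_mem T x⟩

theorem resolventOp_mem_graph (T : SelfAdjointOp H) (z : ℂ) (hz : z.im ≠ 0) (y : H) :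
    (resolventOp T z hz y, y - z • resolventOp T z hz y) ∈ T.1.graph := by
  obtain ⟨h, e⟩ := resolventOp_spec T z hz y
  have := LinearPMap.mem_graph T.1 ⟨_, h⟩
  rwa [eq_sub_of_add_eq' e] at this

theorem resolventOp_of_mem_graph (T : SelfAdjointOp H) (z : ℂ) (hz : z.im ≠ 0) {x y : H}
    (h : (x, y) ∈ T.1.graph) : resolventOp T z hz (z • x + y) = x := by
  obtain ⟨u, hu1, hu2⟩ := (LinearPMap.mem_graph_iff _).mp h
  have hu1 : (u : H) = x := hu1
  have hu2 : T.1 u = y := hu2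
  rw [← hu1, ← hu2, resolventOp_apply]

theorem graph_unique (T : SelfAdjointOp H) {x y y' : H} (h : (x, y) ∈ T.1.graph)
    (h' : (x, y') ∈ T.1.graph) : y = y' :=
  LinearPMap.mem_graph_snd_inj T.1 h h' rfl

theorem add_mem_graph (T : SelfAdjointOp H) {x y x' y' : H} (h : (x, y) ∈ T.1.graph)
    (h' : (x', y') ∈ T.1.graph) : (x + x', y + y') ∈ T.1.graph :=
  T.1.graph.add_mem h h'

theorem smul_mem_graph (T : SelfAdjointOp H) (c : ℂ) {x y : H} (h : (x, y) ∈ T.1.graph) :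
    (c • x, c • y) ∈ T.1.graph :=
  T.1.graph.smul_mem c h

theorem inner_graph (T : SelfAdjointOp H) {x y x' y' : H} (h : (x, y) ∈ T.1.graph)
    (h' : (x', y') ∈ T.1.graph) : ⟪y, x'⟫_ℂ = ⟪x, y'⟫_ℂ := by
  obtain ⟨u, hu1, hu2⟩ := (LinearPMap.mem_graph_iff _).mp h
  obtain ⟨v, hv1, hv2⟩ := (LinearPMap.mem_graph_iff _).mp h'
  have hu1 : (u : H) = x := hu1
  have hu2 : T.1 u = y := hu2
  have hv1 : (v : H) = x' := hv1
  have hv2 : T.1 v = y' := hv2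
  rw [← hu1, ← hu2, ← hv1, ← hv2, inner_symm]

theorem invSqrt_nonneg (T : SelfAdjointOp H) : 0 ≤ invSqrt T := CFC.sqrt_nonneg _

theorem invSqrt_isSelfAdjoint (T : SelfAdjointOp H) : IsSelfAdjoint (invSqrt T) :=
  IsSelfAdjoint.of_nonneg (invSqrt_nonneg T)

theorem invSqrt_mul_self (T : SelfAdjointOp H) : invSqrt T * invSqrt T = invOneAddSq T :=
  CFC.sqrt_mul_sqrt_self _ (invOneAddSq_nonneg T)

/-- For u = (T + z)⁻¹(T + w)⁻¹x, the vector (T + w)u lies in the domain and T + z sends it to x. -/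
theorem resolventOp_commute (T : SelfAdjointOp H) (z w : ℂ) (hz : z.im ≠ 0) (hw : w.im ≠ 0) :
    Commute (resolventOp T z hz) (resolventOp T w hw) := by
  ext x
  change resolventOp T z hz (resolventOp T w hw x) = resolventOp T w hw (resolventOp T z hz x)
  have h1 := resolventOp_mem_graph T w hw x
  have h2 := resolventOp_mem_graph T z hz (resolventOp T w hw x)
  set v := resolventOp T w hw x
  set u := resolventOp T z hz v
  have h3 : (v - z • u, x - w • v - z • (v - z • u)) ∈ T.1.graph :=
    T.1.graph.sub_mem h1 (T.1.graph.smul_mem z h2)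
  have h4 := resolventOp_of_mem_graph T z hz (add_mem_graph T h3 (smul_mem_graph T w h2))
  have h5 := resolventOp_of_mem_graph T w hw h2
  have : z • (v - z • u + w • u) + (x - w • v - z • (v - z • u) + w • (v - z • u)) = x := by
    module
  rw [this] at h4
  rw [h4]
  refine h5.symm.trans (congrArg _ ?_)
  abel

/-- The square root belongs to the functional calculus of (I + T²)⁻¹, hence commutes with whatever
commutes with that operator. -/
theorem invSqrt_commute_resolventOp (T : SelfAdjointOp H) (z : ℂ) (hz : z.im ≠ 0) :
    Commute (invSqrt T) (resolventOp T z hz) := by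
  have h : Commute (invOneAddSq T) (resolventOp T z hz) :=
    (resolventOp_commute T _ z _ hz).mul_left (resolventOp_commute T _ z _ hz)
  exact h.cfcₙ_nnreal _

/-- `(I + T²)^(-1/2)` commutes with `T`. -/
theorem invSqrt_mem_graph (T : SelfAdjointOp H) {x y : H} (h : (x, y) ∈ T.1.graph) :
    (invSqrt T x, invSqrt T y) ∈ T.1.graph := by
  have h1 := resolventOp_of_mem_graph T Complex.I I_im_ne h
  have h2 := resolventOp_mem_graph T Complex.I I_im_ne (invSqrt T (Complex.I • x + y))
  have h3 : resolventOp T Complex.I I_im_ne (invSqrt T (Complex.I • x + y)) = invSqrt T x := by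
    refine (congrArg (fun A : H →L[ℂ] H => A (Complex.I • x + y))
      (invSqrt_commute_resolventOp T _ I_im_ne).eq).symm.trans ?_
    exact congrArg (invSqrt T) h1
  rw [h3] at h2
  convert h2 using 2
  simp

theorem rieszMap_of_mem_graph (T : SelfAdjointOp H) {x y : H} (h : (x, y) ∈ T.1.graph) :
    rieszMap T x = invSqrt T y :=
  graph_unique T (invSqrt_rieszMap_mem_graph T x) (invSqrt_mem_graph T h)

theorem invSqrt_rieszMap (T : SelfAdjointOp H) (x : H) :
    invSqrt T (rieszMap T x) = rieszMap T (invSqrt T x) :=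
  (rieszMap_of_mem_graph T (invSqrt_rieszMap_mem_graph T x)).symm

theorem invSqrt_commute_rieszMap (T : SelfAdjointOp H) : Commute (invSqrt T) (rieszMap T) :=
  ContinuousLinearMap.ext (invSqrt_rieszMap T)

theorem inner_rieszMap (T : SelfAdjointOp H) (x y : H) :
    ⟪rieszMap T x, y⟫_ℂ = ⟪x, rieszMap T y⟫_ℂ := by
  -- By density it is enough to take y = Sz, where the claim becomes the symmetry of T on its graph.
  have hc := (invSqrt_denseRange T).equalizer
    (g := fun y => ⟪rieszMap T x, y⟫_ℂ) (h := fun y => ⟪x, rieszMap T y⟫_ℂ)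
    (by fun_prop) (by fun_prop) ?_
  · exact congrFun hc y
  · funext z
    have h1 := invSqrt_rieszMap_mem_graph T z
    simp only [Function.comp]
    rw [inner_graph T (invSqrt_rieszMap_mem_graph T x) h1, inner_invSqrt,
      ← invSqrt_rieszMap]

theorem rieszMap_sq_add (T : SelfAdjointOp H) (x : H) :
    rieszMap T (rieszMap T x) + invSqrt T (invSqrt T x) = x := by
  obtain ⟨h, h', e⟩ := invOneAddSq_spec T x
  have h1 : (invOneAddSq T x, T.1 ⟨_, h⟩) ∈ T.1.graph := LinearPMap.mem_graph T.1 ⟨_, h⟩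
  have h2 : (T.1 ⟨_, h⟩, T.1 ⟨_, h'⟩) ∈ T.1.graph := LinearPMap.mem_graph T.1 ⟨_, h'⟩
  have h3 := invSqrt_rieszMap_mem_graph T (rieszMap T x)
  have h4 : invSqrt T (rieszMap T x) = T.1 ⟨_, h⟩ := by
    rw [invSqrt_rieszMap]
    refine graph_unique T (invSqrt_rieszMap_mem_graph T (invSqrt T x)) ?_
    rw [invSqrt_sq]
    exact h1
  rw [h4] at h3
  rw [graph_unique T h3 h2, invSqrt_sq, add_comm]
  exact e

theorem rieszMap_mul_self (T : SelfAdjointOp H) :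
    rieszMap T * rieszMap T = 1 - invSqrt T * invSqrt T :=
  eq_sub_of_add_eq (ContinuousLinearMap.ext (rieszMap_sq_add T))

theorem norm_sq_invSqrt_add (T : SelfAdjointOp H) (x : H) :
    ‖rieszMap T x‖ ^ 2 + ‖invSqrt T x‖ ^ 2 = ‖x‖ ^ 2 := by
  have h : ⟪rieszMap T (rieszMap T x) + invSqrt T (invSqrt T x), x⟫_ℂ = ⟪x, x⟫_ℂ := by
    rw [rieszMap_sq_add]
  rw [inner_add_left, inner_rieszMap, inner_invSqrt, inner_self_ofReal, inner_self_ofReal,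
    inner_self_ofReal] at h
  exact_mod_cast h

theorem norm_invSqrt_apply_le (T : SelfAdjointOp H) (x : H) : ‖invSqrt T x‖ ≤ ‖x‖ := by
  have := norm_sq_invSqrt_add T x
  exact le_of_sq_le_sq (by nlinarith [sq_nonneg ‖rieszMap T x‖]) (norm_nonneg _)

theorem norm_rieszMap_apply_le (T : SelfAdjointOp H) (x : H) : ‖rieszMap T x‖ ≤ ‖x‖ := by
  have := norm_sq_invSqrt_add T x
  exact le_of_sq_le_sq (by nlinarith [sq_nonneg ‖invSqrt T x‖]) (norm_nonneg _)

theorem norm_invSqrt_le (T : SelfAdjointOp H) : ‖invSqrt T‖ ≤ 1 :=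
  ContinuousLinearMap.opNorm_le_bound _ zero_le_one fun x => by
    simpa using norm_invSqrt_apply_le T x

theorem norm_rieszMap_le (T : SelfAdjointOp H) : ‖rieszMap T‖ ≤ 1 :=
  ContinuousLinearMap.opNorm_le_bound _ zero_le_one fun x => by
    simpa using norm_rieszMap_apply_le T x

/-- The range of `(I + T²)^(-1/2)` is the whole domain of `T`. -/
theorem invSqrt_of_mem_graph (T : SelfAdjointOp H) {x y : H} (h : (x, y) ∈ T.1.graph) :
    invSqrt T (invSqrt T x + rieszMap T y) = x := by
  rw [map_add, invSqrt_rieszMap, ← rieszMap_of_mem_graph T h, add_comm, rieszMap_sq_add]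

/-- `(T + i)⁻¹ = T (I + T²)⁻¹ - i (I + T²)⁻¹`, in terms of the bounded transform. -/
theorem resolventOp_I_eq (T : SelfAdjointOp H) : resolventOp T Complex.I I_im_ne =
    rieszMap T * invSqrt T - Complex.I • (1 - rieszMap T * rieszMap T) := by
  ext x
  have h1 := invSqrt_rieszMap_mem_graph T (rieszMap T x)
  have h2 := smul_mem_graph T (-Complex.I) (invSqrt_rieszMap_mem_graph T (invSqrt T x))
  have h3 := resolventOp_of_mem_graph T Complex.I I_im_ne (add_mem_graph T h1 h2)
  have h4 := rieszMap_sq_add T x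
  have h5 : Complex.I • (invSqrt T (rieszMap T x) + -Complex.I • invSqrt T (invSqrt T x)) +
      (rieszMap T (rieszMap T x) + -Complex.I • rieszMap T (invSqrt T x)) = x := by
    rw [invSqrt_rieszMap]
    refine Eq.trans ?_ h4
    rw [smul_add, smul_smul, mul_neg, Complex.I_mul_I]
    module
  rw [h5] at h3
  rw [h3, invSqrt_rieszMap]
  have h6 : invSqrt T (invSqrt T x) = x - rieszMap T (rieszMap T x) := eq_sub_of_add_eq' h4
  rw [h6]
  simp [sub_eq_add_neg, add_comm]

/-! ### Bounded perturbations -/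

theorem addBounded_mem_graph (D : SelfAdjointOp H) (C : BoundedSelfAdjointOp H) {x y : H} :
    (x, y) ∈ (addBounded D C).1.graph ↔ (x, y - C.1 x) ∈ D.1.graph := by
  simp only [LinearPMap.mem_graph_iff]
  constructor
  · rintro ⟨u, hu1, hu2⟩
    refine ⟨u, hu1, ?_⟩
    have hu1 : (u : H) = x := hu1
    have hu2 : C.1 (u : H) + D.1 u = y := hu2
    change D.1 u = y - C.1 x
    rw [← hu1, ← hu2, add_sub_cancel_left]
  · rintro ⟨u, hu1, hu2⟩
    refine ⟨u, hu1, ?_⟩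
    have hu1 : (u : H) = x := hu1
    have hu2 : D.1 u = y - C.1 x := hu2
    change C.1 (u : H) + D.1 u = y
    rw [hu2, hu1, add_sub_cancel]

/-- `T₂ = T₁ + B` as unbounded operators with the same domain. -/
def IsPerturbation (T₁ T₂ : SelfAdjointOp H) (B : H →L[ℂ] H) : Prop :=
  ∀ x y, (x, y) ∈ T₁.1.graph ↔ (x, y + B x) ∈ T₂.1.graph

theorem isPerturbation_addBounded (D : SelfAdjointOp H) (C₁ C₂ : BoundedSelfAdjointOp H) :
    IsPerturbation (addBounded D C₁) (addBounded D C₂) (C₂.1 - C₁.1) := by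
  intro x y
  rw [addBounded_mem_graph, addBounded_mem_graph, sub_apply]
  rw [show y + (C₂.1 x - C₁.1 x) - C₂.1 x = y - C₁.1 x by abel]

theorem isPerturbation_self_addBounded (D : SelfAdjointOp H) (C : BoundedSelfAdjointOp H) :
    IsPerturbation D (addBounded D C) C.1 := by
  intro x y
  rw [addBounded_mem_graph, add_sub_cancel_right]

theorem IsPerturbation.symm {T₁ T₂ : SelfAdjointOp H} {B : H →L[ℂ] H}
    (h : IsPerturbation T₁ T₂ B) : IsPerturbation T₂ T₁ (-B) := by
  intro x y
  rw [h x (y + (-B) x), neg_apply, neg_add_cancel_right]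

variable {T₁ T₂ : SelfAdjointOp H} {B : H →L[ℂ] H}

/-- The point (S₁x, F₁x) of the graph of T₁ gives (S₁x, F₁x + BS₁x) in the graph of T₂, and F₂ =
S₂T₂ on the domain. -/
theorem IsPerturbation.invSqrt_mul_mul (h : IsPerturbation T₁ T₂ B) :
    invSqrt T₂ * B * invSqrt T₁ = rieszMap T₂ * invSqrt T₁ - invSqrt T₂ * rieszMap T₁ := by
  ext x
  have h1 := (h _ _).mp (invSqrt_rieszMap_mem_graph T₁ x)
  have h2 := rieszMap_of_mem_graph T₂ h1
  simp [h2]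

/-- The resolvent identity. -/
theorem IsPerturbation.resolventOp_sub (h : IsPerturbation T₁ T₂ B) (z : ℂ) (hz : z.im ≠ 0) :
    resolventOp T₁ z hz - resolventOp T₂ z hz = resolventOp T₂ z hz * B * resolventOp T₁ z hz := by
  ext x
  have h1 := (h _ _).mp (resolventOp_mem_graph T₁ z hz x)
  have h2 := resolventOp_of_mem_graph T₂ z hz h1
  have h3 : z • resolventOp T₁ z hz x + (x - z • resolventOp T₁ z hz x + B (resolventOp T₁ z hz x))
      = x + B (resolventOp T₁ z hz x) := by abel
  rw [h3, map_add] at h2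
  simpa using (eq_sub_of_add_eq' h2).symm

/-- If `‖B (I + T₁²)^(-1/2)‖` is small, then `(I + T₂²)^(-1/2) y` is in the range of
`(I + T₁²)^(-1/2)` on the ball of radius `4 ‖y‖`. -/
theorem IsPerturbation.exists_invSqrt_eq (h : IsPerturbation T₁ T₂ B)
    (hB : ‖B * invSqrt T₁‖ ≤ 1 / 2) (y : H) :
    ∃ z, invSqrt T₁ z = invSqrt T₂ y ∧ ‖z‖ ≤ 4 * ‖y‖ := by
  have h1 : (invSqrt T₂ y, rieszMap T₂ y + (-B) (invSqrt T₂ y)) ∈ T₁.1.graph :=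
    (h.symm _ _).mp (invSqrt_rieszMap_mem_graph T₂ y)
  have h2 := invSqrt_of_mem_graph T₁ h1
  set x := invSqrt T₂ y with hx
  set z := invSqrt T₁ x + rieszMap T₁ (rieszMap T₂ y + (-B) x) with hz
  refine ⟨z, h2, ?_⟩
  have h3 : ‖z‖ ≤ ‖x‖ + (‖rieszMap T₂ y‖ + ‖B x‖) := by
    refine (norm_add_le _ _).trans (add_le_add (norm_invSqrt_apply_le _ _) ?_)
    refine (norm_rieszMap_apply_le _ _).trans ((norm_add_le _ _).trans ?_)
    rw [neg_apply, norm_neg]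
  -- Smallness of BS₁ lets this term be absorbed: ‖z‖ ≤ 2‖y‖ + ‖z‖/2, whence the constant 4.
  have h4 : ‖B x‖ ≤ 1 / 2 * ‖z‖ := by
    rw [← h2]
    exact ((B * invSqrt T₁).le_opNorm z).trans (by gcongr)
  have h5 := norm_invSqrt_apply_le T₂ y
  have h6 := norm_rieszMap_apply_le T₂ y
  linarith

theorem IsPerturbation.norm_mul_invSqrt_le (h : IsPerturbation T₁ T₂ B)
    (hB : ‖B * invSqrt T₁‖ ≤ 1 / 2) : ‖B * invSqrt T₂‖ ≤ 4 * ‖B * invSqrt T₁‖ := by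
  refine ContinuousLinearMap.opNorm_le_bound _ (by positivity) fun y => ?_
  obtain ⟨z, hz, hzy⟩ := h.exists_invSqrt_eq hB y
  have h1 : (B * invSqrt T₂) y = (B * invSqrt T₁) z := by simp [hz]
  rw [h1]
  calc _ ≤ ‖B * invSqrt T₁‖ * ‖z‖ := (B * invSqrt T₁).le_opNorm z
    _ ≤ ‖B * invSqrt T₁‖ * (4 * ‖y‖) := by gcongr
    _ = _ := by ring

end

/-! ### Operator equations and estimates for bounded operators -/

/-- A nonzero compact operator has a singular vector for its norm. -/
theorem exists_singularVector {X : H →L[ℂ] H} (hX : IsCompactOperator X) (h0 : X ≠ 0) :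
    ∃ y : H, y ≠ 0 ∧ X.adjoint (X y) = ((‖X‖ ^ 2 : ℝ) : ℂ) • y := by
  have : Nontrivial H := by
    by_contra h
    rw [not_nontrivial_iff_subsingleton] at h
    exact h0 (ContinuousLinearMap.ext fun x => Subsingleton.elim _ _)
  have hA : IsSelfAdjoint (X.adjoint * X) := by
    have := IsSelfAdjoint.star_mul_self X
    rwa [ContinuousLinearMap.star_eq_adjoint] at this
  have hn : ‖X.adjoint * X‖ = ‖X‖ ^ 2 := by
    rw [← ContinuousLinearMap.star_eq_adjoint, CStarRing.norm_star_mul_self, sq]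
  have hc : IsCompactOperator (X.adjoint * X) := hX.clm_comp X.adjoint
  obtain ⟨μ, hμ, hr⟩ := spectrum.exists_nnnorm_eq_spectralRadius (X.adjoint * X)
  rw [hA.spectralRadius_eq_nnnorm] at hr
  have hr : ‖μ‖ = ‖X‖ ^ 2 := by
    rw [← hn]
    exact congrArg NNReal.toReal (ENNReal.coe_injective hr)
  have hX0 : 0 < ‖X‖ := norm_pos_iff.mpr h0
  have hμ0 : μ ≠ 0 := by
    rw [← norm_ne_zero_iff, hr]
    positivity
  obtain ⟨y, hy⟩ := ((hc.hasEigenvalue_iff_mem_spectrum hμ0).mpr hμ).exists_hasEigenvector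
  have hy1 : X.adjoint (X y) = μ • y := hy.apply_eq_smul
  have hy0 : 0 < ‖y‖ := norm_pos_iff.mpr hy.2
  -- So far only the modulus of μ is known; pairing with y shows that μ is real and nonnegative.
  have h1 : ((‖X y‖ ^ 2 : ℝ) : ℂ) = μ * ((‖y‖ ^ 2 : ℝ) : ℂ) := by
    rw [← inner_self_ofReal, ← inner_self_ofReal, ← inner_smul_right, ← hy1,
      ContinuousLinearMap.adjoint_inner_right]
  have h2 : μ = ((‖X y‖ ^ 2 / ‖y‖ ^ 2 : ℝ) : ℂ) := by
    rw [Complex.ofReal_div, h1, mul_div_cancel_right₀]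
    exact_mod_cast (pow_pos hy0 2).ne'
  refine ⟨y, hy.2, ?_⟩
  rw [hy1, ← hr, h2, Complex.norm_real, Real.norm_of_nonneg (by positivity)]

theorem inner_nonneg_op {E : Type*} [NormedAddCommGroup E] [InnerProductSpace ℂ E]
    {A : E →L[ℂ] E} (hA : 0 ≤ A) (x y : E) : ⟪A x, y⟫_ℂ = ⟪x, A y⟫_ℂ :=
  ((ContinuousLinearMap.nonneg_iff_isPositive _).mp hA).isSymmetric x y

/-- For singular vectors with Xy = gx, X*x = gy and g = ‖X‖, pairing the equation applied to y with
x gives g(‖px‖² + ‖qy‖²) = ⟪px, Jqy⟫ ≤ ‖J‖‖px‖‖qy‖, and the arithmetic-geometric mean inequality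
finishes. Injectivity of p keeps the cancelled factor positive. -/
theorem norm_le_of_sylvester_of_isCompactOperator {p q X J : H →L[ℂ] H} (hp : 0 ≤ p) (hq : 0 ≤ q)
    (hpi : Function.Injective p) (hX : IsCompactOperator X)
    (h : p * p * X + X * (q * q) = p * J * q) : ‖X‖ ≤ ‖J‖ / 2 := by
  rcases eq_or_ne X 0 with rfl | h0
  · rw [norm_zero]; positivity
  obtain ⟨y, hy0, hy⟩ := exists_singularVector hX h0
  have hg : 0 < ‖X‖ := norm_pos_iff.mpr h0
  set g := ‖X‖ with hgdef
  set x : H := ((g⁻¹ : ℝ) : ℂ) • X y with hx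
  have hgc : (g : ℂ) ≠ 0 := by exact_mod_cast hg.ne'
  have hXy : X y = (g : ℂ) • x := by
    rw [hx, smul_smul, Complex.ofReal_inv, mul_inv_cancel₀ hgc, one_smul]
  have hXx : X.adjoint x = (g : ℂ) • y := by
    rw [hx, map_smul, hy, smul_smul]
    congr 1
    push_cast
    field_simp
  clear_value x
  have hxne : x ≠ 0 := by
    rintro h1
    rw [hXy, h1, smul_zero, map_zero] at hy
    rcases smul_eq_zero.mp hy.symm with h2 | h2
    · exact (pow_pos hg 2).ne' (by exact_mod_cast h2)
    · exact hy0 h2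
  have hpx : 0 < ‖p x‖ := norm_pos_iff.mpr fun h1 => hxne (hpi (by rw [h1, map_zero]))
  have e1 : ⟪x, (p * p * X + X * (q * q)) y⟫_ℂ = ((g * (‖p x‖ ^ 2 + ‖q y‖ ^ 2) : ℝ) : ℂ) := by
    have e2 : (p * p * X + X * (q * q)) y = p (p (X y)) + X (q (q y)) := rfl
    rw [e2, inner_add_right, ← inner_nonneg_op hp, hXy, map_smul, inner_smul_right,
      inner_self_ofReal, ← ContinuousLinearMap.adjoint_inner_left, hXx, inner_smul_left,
      Complex.conj_ofReal, ← inner_nonneg_op hq, inner_self_ofReal]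
    push_cast
    ring
  have e3 : ⟪x, (p * J * q) y⟫_ℂ = ⟪p x, J (q y)⟫_ℂ := (inner_nonneg_op hp _ _).symm
  rw [h, e3] at e1
  have e4 : g * (‖p x‖ ^ 2 + ‖q y‖ ^ 2) ≤ ‖p x‖ * (‖J‖ * ‖q y‖) := by
    have e5 := norm_inner_le_norm (𝕜 := ℂ) (p x) (J (q y))
    rw [e1, Complex.norm_real, Real.norm_of_nonneg (by positivity)] at e5
    exact e5.trans (by gcongr; exact J.le_opNorm _)
  have e6 : ‖p x‖ * (‖J‖ * ‖q y‖) ≤ ‖J‖ / 2 * (‖p x‖ ^ 2 + ‖q y‖ ^ 2) := by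
    nlinarith [mul_nonneg (norm_nonneg J) (sq_nonneg (‖p x‖ - ‖q y‖))]
  exact le_of_mul_le_mul_right (e4.trans e6) (by positivity)

/-- The bounded operator `W = (S + η)⁻¹`, for `S` positive and `η > 0`. -/
theorem exists_inv_add_scalar {S : H →L[ℂ] H} (hS : 0 ≤ S) {η : ℝ} (hη : 0 < η) :
    ∃ W : H →L[ℂ] H, S * W + (η : ℂ) • W = 1 ∧ W * S + (η : ℂ) • W = 1 ∧ ‖W‖ ≤ η⁻¹ ∧
      ‖S * W‖ ≤ 1 := by
  have hu : IsUnit (S + algebraMap ℝ (H →L[ℂ] H) η) := by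
    have h1 : -η ∉ spectrum ℝ S := fun h => by
      have := spectrum_nonneg_of_nonneg hS h
      linarith
    rw [spectrum.notMem_iff] at h1
    rw [← IsUnit.neg_iff]
    convert h1 using 1
    rw [map_neg]
    abel
  have ha : algebraMap ℝ (H →L[ℂ] H) η = (η : ℂ) • 1 := by
    rw [Algebra.algebraMap_eq_smul_one]
    ext x
    simp
  rw [ha] at hu
  obtain ⟨u, hu⟩ := hu
  have e1 : S * (↑u⁻¹ : H →L[ℂ] H) + (η : ℂ) • (↑u⁻¹ : H →L[ℂ] H) = 1 := by
    have := u.mul_inv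
    rwa [hu, add_mul, smul_mul_assoc, one_mul] at this
  have e2 : (↑u⁻¹ : H →L[ℂ] H) * S + (η : ℂ) • (↑u⁻¹ : H →L[ℂ] H) = 1 := by
    have := u.inv_mul
    rwa [hu, mul_add, mul_smul_comm, mul_one] at this
  set W : H →L[ℂ] H := ↑u⁻¹
  -- Expand ‖SWx + ηWx‖² = ‖x‖²; the cross term is nonnegative because S ≥ 0. Both norm bounds
  -- follow.
  have key : ∀ x, ‖S (W x)‖ ^ 2 + (η * ‖W x‖) ^ 2 ≤ ‖x‖ ^ 2 := by
    intro x
    have hx : S (W x) + (η : ℂ) • W x = x := congrArg (fun A : H →L[ℂ] H => A x) e1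
    have hpos := ((ContinuousLinearMap.nonneg_iff_isPositive _).mp hS).re_inner_nonneg_left (W x)
    have h1 := norm_add_sq (𝕜 := ℂ) (S (W x)) ((η : ℂ) • W x)
    rw [hx, inner_smul_right, norm_smul, Complex.norm_real, Real.norm_of_nonneg hη.le] at h1
    have h2 : RCLike.re ((η : ℂ) * ⟪S (W x), W x⟫_ℂ) = η * RCLike.re ⟪S (W x), W x⟫_ℂ := by
      simp
    rw [h2] at h1
    have h3 := mul_nonneg hη.le hpos
    rw [h1]
    linarith
  refine ⟨W, e1, e2, ?_, ?_⟩
  · refine ContinuousLinearMap.opNorm_le_bound _ (by positivity) fun x => ?_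
    have h1 : η * ‖W x‖ ≤ ‖x‖ :=
      le_of_sq_le_sq (by nlinarith [key x, sq_nonneg ‖S (W x)‖]) (norm_nonneg _)
    rwa [inv_mul_eq_div, le_div_iff₀ hη, mul_comm]
  · refine ContinuousLinearMap.opNorm_le_bound _ zero_le_one fun x => ?_
    rw [one_mul]
    refine le_of_sq_le_sq ?_ (norm_nonneg _)
    change ‖S (W x)‖ ^ 2 ≤ _
    linarith [key x, sq_nonneg (η * ‖W x‖)]

/-- The solution `G` of `p² G + G q² = p J q` satisfies `‖G‖ ≤ ‖J‖ / 2`, if `q⁴` is compact. -/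
theorem norm_le_of_sylvester {p q G J : H →L[ℂ] H} (hp : 0 ≤ p) (hq : 0 ≤ q)
    (hpi : Function.Injective p) (hqi : DenseRange (q * q))
    (hqc : IsCompactOperator (q * q * (q * q)))
    (h : p * p * G + G * (q * q) = p * J * q) : ‖G‖ ≤ ‖J‖ / 2 := by
  have hS : (0 : H →L[ℂ] H) ≤ q * q := by
    have := star_mul_self_nonneg q
    rwa [(IsSelfAdjoint.of_nonneg hq).star_eq] at this
  have hkey : ∀ x, ‖G (q (q x))‖ ≤ ‖J‖ / 2 * ‖q (q x)‖ := by
    intro x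
    -- G itself need not be compact. It is replaced by GE² with E = q²(q² + η)⁻¹, a contraction
    -- commuting with q, so that GE² solves the same equation with JE² for J. On the range of q² the
    -- error is O(η).
    have hη : ∀ η : ℝ, 0 < η →
        ‖G (q (q x))‖ ≤ ‖J‖ / 2 * ‖q (q x)‖ + 2 * η * (‖G‖ * ‖x‖) := by
      intro η hη
      obtain ⟨W, e1, e2, -, hW⟩ := exists_inv_add_scalar hS hη
      have hη0 : (η : ℂ) ≠ 0 := by exact_mod_cast hη.ne'
      have hcomm : Commute (q * q) W := by
        have : q * q * W + (η : ℂ) • W = W * (q * q) + (η : ℂ) • W := e1.trans e2.symm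
        exact add_right_cancel this
      have hWq : Commute W q := by
        have h1 : W * (q * (q * q * W + (η : ℂ) • W)) = W * ((q * q * q + (η : ℂ) • q) * W) := by
          simp only [mul_add, add_mul, smul_mul_assoc, mul_smul_comm, mul_assoc]
        have h2 : W * (q * q * q + (η : ℂ) • q) = (W * (q * q) + (η : ℂ) • W) * q := by
          simp only [mul_add, add_mul, smul_mul_assoc, mul_smul_comm, mul_assoc]
        rw [e1, mul_one, ← mul_assoc, h2, e2, one_mul] at h1
        exact h1
      set E := (q * q) * W with hE
      have hEq : Commute E q := ((Commute.refl q).mul_left (Commute.refl q)).mul_left hWq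
      -- One factor E would only supply q²; its square supplies the compact operator q⁴.
      have hEc : IsCompactOperator (E * E) := by
        have : E * E = (q * q * (q * q)) * (W * W) := by
          rw [hE, mul_assoc, ← mul_assoc W, ← hcomm.eq]
          simp only [mul_assoc]
        rw [this]
        exact hqc.comp_clm (W * W)
      have hXc : IsCompactOperator (G * (E * E)) := hEc.clm_comp G
      have hEE : Commute (E * E) q := hEq.mul_left hEq
      have hsyl : p * p * (G * (E * E)) + G * (E * E) * (q * q) = p * (J * (E * E)) * q := by
        have h1 : G * (E * E) * (q * q) = G * (q * q) * (E * E) := by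
          rw [mul_assoc, (hEE.mul_right hEE).eq, ← mul_assoc]
        have h2 : p * (J * (E * E)) * q = p * J * q * (E * E) := by
          rw [mul_assoc p, mul_assoc J, hEE.eq]
          simp only [mul_assoc]
        rw [h1, h2, ← h, add_mul]
        simp only [mul_assoc]
      have hb := norm_le_of_sylvester_of_isCompactOperator hp hq hpi hXc hsyl
      have hEE1 : ‖E * E‖ ≤ 1 := (norm_mul_le _ _).trans (mul_le_one₀ hW (norm_nonneg _) hW)
      have hb2 : ‖G * (E * E)‖ ≤ ‖J‖ / 2 := hb.trans (by
        have := norm_mul_le J (E * E)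
        nlinarith [norm_nonneg J])
      have hres : q * q - E * E * (q * q) = (η : ℂ) • (E + E * E) := by
        have h1 : (1 : H →L[ℂ] H) - E = (η : ℂ) • W := by rw [← e1]; abel
        have h2 : q * q - E * (q * q) = (η : ℂ) • E := by
          calc q * q - E * (q * q) = (1 - E) * (q * q) := by rw [sub_mul, one_mul]
            _ = _ := by rw [h1, smul_mul_assoc, ← hcomm.eq]
        calc q * q - E * E * (q * q)
            = (q * q - E * (q * q)) + E * (q * q - E * (q * q)) := by
              rw [mul_sub, mul_assoc]; abel
          _ = _ := by rw [h2, mul_smul_comm, smul_add]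
      have h3 : q (q x) = (E * E) (q (q x)) + (η : ℂ) • (E x + (E * E) x) := by
        have := congrArg (fun A : H →L[ℂ] H => A x) (sub_eq_iff_eq_add'.mp hres)
        simpa using this
      have h4 : G (q (q x)) = (G * (E * E)) (q (q x)) + (η : ℂ) • G (E x + (E * E) x) := by
        conv_lhs => rw [h3]
        rw [map_add, map_smul]
        rfl
      rw [h4]
      refine (norm_add_le _ _).trans (add_le_add ?_ ?_)
      · exact (ContinuousLinearMap.le_opNorm _ _).trans (by gcongr)
      · rw [norm_smul, Complex.norm_real, Real.norm_of_nonneg hη.le]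
        have h5 : ‖E x + (E * E) x‖ ≤ 2 * ‖x‖ := by
          refine (norm_add_le _ _).trans ?_
          have := E.le_of_opNorm_le hW x
          have := (E * E).le_of_opNorm_le hEE1 x
          linarith
        calc η * ‖G (E x + (E * E) x)‖ ≤ η * (‖G‖ * (2 * ‖x‖)) := by
              gcongr
              exact (G.le_opNorm _).trans (by gcongr)
          _ = _ := by ring
    refine le_of_forall_pos_le_add fun ε hε => ?_
    have hc : 0 ≤ ‖G‖ * ‖x‖ := by positivity
    refine (hη (ε / (2 * (‖G‖ * ‖x‖ + 1))) (by positivity)).trans ?_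
    refine add_le_add le_rfl ?_
    have e : 2 * (ε / (2 * (‖G‖ * ‖x‖ + 1))) * (‖G‖ * ‖x‖) =
        ε * (‖G‖ * ‖x‖ / (‖G‖ * ‖x‖ + 1)) := by
      field_simp
    rw [e]
    exact mul_le_of_le_one_right hε.le (div_le_one_of_le₀ (by linarith) (by positivity))
  refine ContinuousLinearMap.opNorm_le_bound _ (by positivity) fun x => ?_
  have hcl : IsClosed {x | ‖G x‖ ≤ ‖J‖ / 2 * ‖x‖} :=
    isClosed_le (by fun_prop) (by fun_prop)
  exact hqi.induction_on (p := fun x => ‖G x‖ ≤ ‖J‖ / 2 * ‖x‖) x hcl hkey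

/-- Interpolation: `‖p B q‖² ≤ ‖p² B‖ ‖q² B‖`. -/
theorem norm_mul_mul_sq_le {p q B : H →L[ℂ] H} (hp : IsSelfAdjoint p) (hq : IsSelfAdjoint q)
    (hB : IsSelfAdjoint B) : ‖p * B * q‖ ^ 2 ≤ ‖p * p * B‖ * ‖q * q * B‖ := by
  rcases subsingleton_or_nontrivial H with _ | _
  · have : p * B * q = 0 := ContinuousLinearMap.ext fun x => Subsingleton.elim _ _
    rw [this, norm_zero, zero_pow two_ne_zero]
    positivity
  set Y := p * (B * (q * q) * B * p) with hY
  have e1 : p * B * q * star (p * B * q) = Y := by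
    rw [star_mul, star_mul, hp.star_eq, hq.star_eq, hB.star_eq]
    simp only [hY, mul_assoc]
  have hYs : IsSelfAdjoint Y := e1 ▸ IsSelfAdjoint.mul_star_self _
  have hYn : ‖Y‖ = ‖p * B * q‖ ^ 2 := by rw [← e1, CStarRing.norm_self_mul_star, sq]
  rw [← hYn]
  -- Y is self-adjoint, so its norm is attained on the spectrum. Moving the leading p to the end
  -- preserves nonzero spectrum and turns Y into (Bq²)(Bp²), to which submultiplicativity applies.
  obtain ⟨μ, hμ, hr⟩ := spectrum.exists_nnnorm_eq_spectralRadius Y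
  rw [hYs.spectralRadius_eq_nnnorm] at hr
  have hr : ‖μ‖ = ‖Y‖ := congrArg NNReal.toReal (ENNReal.coe_injective hr)
  rw [← hr]
  rcases eq_or_ne μ 0 with rfl | h0
  · rw [norm_zero]; positivity
  have h1 : μ ∈ spectrum ℂ (B * (q * q) * B * p * p) := by
    have := spectrum.nonzero_mul_comm (𝕜 := ℂ) p (B * (q * q) * B * p)
    have h2 : μ ∈ spectrum ℂ Y \ {0} := ⟨hμ, h0⟩
    rw [hY, this] at h2
    exact h2.1
  have e2 : B * (q * q) * B * p * p = star (q * q * B) * star (p * p * B) := by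
    simp only [star_mul, hp.star_eq, hq.star_eq, hB.star_eq, mul_assoc]
  refine (spectrum.norm_le_norm_of_mem h1).trans ?_
  rw [e2, mul_comm ‖p * p * B‖]
  refine (norm_mul_le _ _).trans ?_
  rw [norm_star, norm_star]

section

/-! ### Continuity of the bounded transform -/

theorem norm_mul_comm_of_isSelfAdjoint {A B : H →L[ℂ] H} (hA : IsSelfAdjoint A)
    (hB : IsSelfAdjoint B) : ‖A * B‖ = ‖B * A‖ := by
  rw [← norm_star, star_mul, hA.star_eq, hB.star_eq]

/-- `(I + T²)^(-1/4)`. -/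
noncomputable def invFourthRoot (T : SelfAdjointOp H) : H →L[ℂ] H := CFC.sqrt (invSqrt T)

theorem invFourthRoot_nonneg (T : SelfAdjointOp H) : 0 ≤ invFourthRoot T := CFC.sqrt_nonneg _

theorem invFourthRoot_mul_self (T : SelfAdjointOp H) :
    invFourthRoot T * invFourthRoot T = invSqrt T :=
  CFC.sqrt_mul_sqrt_self _ (invSqrt_nonneg T)

theorem invFourthRoot_injective (T : SelfAdjointOp H) : Function.Injective (invFourthRoot T) := by
  intro x y hxy
  apply invSqrt_injective T
  rw [← invFourthRoot_mul_self]
  exact congrArg (invFourthRoot T) hxy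

theorem invFourthRoot_commute_rieszMap (T : SelfAdjointOp H) :
    Commute (invFourthRoot T) (rieszMap T) :=
  (invSqrt_commute_rieszMap T).cfcₙ_nnreal _

theorem invFourthRoot_commute_invSqrt (T : SelfAdjointOp H) :
    Commute (invFourthRoot T) (invSqrt T) :=
  (Commute.refl (invSqrt T)).cfcₙ_nnreal _

theorem norm_invFourthRoot_apply_sq_le (T : SelfAdjointOp H) (x : H) :
    ‖invFourthRoot T x‖ ^ 2 ≤ ‖invSqrt T x‖ * ‖x‖ := by
  have h : ⟪invSqrt T x, x⟫_ℂ = ((‖invFourthRoot T x‖ ^ 2 : ℝ) : ℂ) := by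
    rw [← inner_self_ofReal, ← inner_nonneg_op (invFourthRoot_nonneg T),
      ← invFourthRoot_mul_self]
    rfl
  have h2 := norm_inner_le_norm (𝕜 := ℂ) (invSqrt T x) x
  rwa [h, Complex.norm_real, Real.norm_of_nonneg (by positivity)] at h2

variable {T₁ T₂ : SelfAdjointOp H} {B : H →L[ℂ] H}

/-- With K = S₂BS₁ = F₂S₁ - S₂F₁, the term K accounts for the mixed products on the left. The
relations F² = 1 - S² reduce S₂KS₁ - F₂KF₁ to the remaining S₂F₂ - F₁S₁. -/
theorem IsPerturbation.sylvester_rieszMap (h : IsPerturbation T₁ T₂ B) :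
    invSqrt T₂ * (rieszMap T₂ - rieszMap T₁) + (rieszMap T₂ - rieszMap T₁) * invSqrt T₁ =
      invSqrt T₂ * B * invSqrt T₁ + invSqrt T₂ * (invSqrt T₂ * B * invSqrt T₁) * invSqrt T₁ -
        rieszMap T₂ * (invSqrt T₂ * B * invSqrt T₁) * rieszMap T₁ := by
  rw [h.invSqrt_mul_mul]
  have c1 := (invSqrt_commute_rieszMap T₁).eq
  have c2 := (invSqrt_commute_rieszMap T₂).eq
  have s1 := rieszMap_mul_self T₁
  have s2 := rieszMap_mul_self T₂
  generalize invSqrt T₁ = S at *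
  generalize invSqrt T₂ = S' at *
  generalize rieszMap T₁ = F at *
  generalize rieszMap T₂ = F' at *
  have a : F' * (F' * S - S' * F) * F = (F' * F') * (S * F) - (F' * S') * (F * F) := by
    noncomm_ring
  rw [a, s1, s2, c1, ← c2]
  noncomm_ring

/-- The fourth roots p of (I + T₂²)⁻¹ and q of (I + T₁²)⁻¹ commute with the respective S and F, so
the right side of the Sylvester equation factors as pJq. Here J is a sum of three terms, each of
norm at most ‖pBq‖, and q⁴ = (I + T₁²)⁻¹ is compact. -/
theorem IsPerturbation.norm_rieszMap_sub_le (h : IsPerturbation T₁ T₂ B)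
    (hc : IsCompactOperator (invOneAddSq T₁)) :
    ‖rieszMap T₂ - rieszMap T₁‖ ≤ 3 / 2 * ‖invFourthRoot T₂ * B * invFourthRoot T₁‖ := by
  have hs := h.sylvester_rieszMap
  have p2 := invFourthRoot_mul_self T₂
  have q2 := invFourthRoot_mul_self T₁
  have pS := (invFourthRoot_commute_invSqrt T₂).eq
  have qS := (invFourthRoot_commute_invSqrt T₁).eq
  have pF := (invFourthRoot_commute_rieszMap T₂).eq
  have qF := (invFourthRoot_commute_rieszMap T₁).eq
  set Z := invFourthRoot T₂ * B * invFourthRoot T₁ with hZ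
  have e0 : invFourthRoot T₂ * Z * invFourthRoot T₁ = invSqrt T₂ * B * invSqrt T₁ := by
    rw [← p2, ← q2, hZ]
    simp only [mul_assoc]
  have e : invFourthRoot T₂ * invFourthRoot T₂ * (rieszMap T₂ - rieszMap T₁) +
      (rieszMap T₂ - rieszMap T₁) * (invFourthRoot T₁ * invFourthRoot T₁) =
      invFourthRoot T₂ * (Z + invSqrt T₂ * Z * invSqrt T₁ - rieszMap T₂ * Z * rieszMap T₁) *
        invFourthRoot T₁ := by
    rw [p2, q2, hs, ← e0]
    simp only [mul_add, mul_sub, add_mul, sub_mul]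
    have a1 : invSqrt T₂ * (invFourthRoot T₂ * Z * invFourthRoot T₁) * invSqrt T₁ =
        invFourthRoot T₂ * (invSqrt T₂ * Z * invSqrt T₁) * invFourthRoot T₁ := by
      calc _ = (invSqrt T₂ * invFourthRoot T₂) * Z * (invFourthRoot T₁ * invSqrt T₁) := by
            simp only [mul_assoc]
        _ = _ := by rw [← pS, qS]; simp only [mul_assoc]
    have a2 : rieszMap T₂ * (invFourthRoot T₂ * Z * invFourthRoot T₁) * rieszMap T₁ =
        invFourthRoot T₂ * (rieszMap T₂ * Z * rieszMap T₁) * invFourthRoot T₁ := by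
      calc _ = (rieszMap T₂ * invFourthRoot T₂) * Z * (invFourthRoot T₁ * rieszMap T₁) := by
            simp only [mul_assoc]
        _ = _ := by rw [← pF, qF]; simp only [mul_assoc]
    rw [a1, a2]
  have hb := norm_le_of_sylvester (invFourthRoot_nonneg T₂) (invFourthRoot_nonneg T₁)
    (invFourthRoot_injective T₂) (by rw [q2]; exact invSqrt_denseRange T₁)
    (by rw [q2, invSqrt_mul_self]; exact hc) e
  have hcontr : ∀ {A A' : H →L[ℂ] H}, ‖A‖ ≤ 1 → ‖A'‖ ≤ 1 → ‖A * Z * A'‖ ≤ ‖Z‖ := by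
    intro A A' hA hA'
    calc ‖A * Z * A'‖ ≤ ‖A‖ * ‖Z‖ * ‖A'‖ :=
          (norm_mul_le _ _).trans (by gcongr; exact norm_mul_le _ _)
      _ ≤ 1 * ‖Z‖ * 1 := by gcongr
      _ = ‖Z‖ := by ring
  have h1 := hcontr (norm_invSqrt_le T₂) (norm_invSqrt_le T₁)
  have h2 := hcontr (norm_rieszMap_le T₂) (norm_rieszMap_le T₁)
  have h3 := norm_sub_le (Z + invSqrt T₂ * Z * invSqrt T₁) (rieszMap T₂ * Z * rieszMap T₁)
  have h4 := norm_add_le Z (invSqrt T₂ * Z * invSqrt T₁)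
  linarith

/-- Interpolation gives ‖pBq‖² ≤ ‖BS₂‖‖BS₁‖ ≤ 4‖BS₁‖², so the factor is 3/2 · 2. -/
theorem IsPerturbation.norm_rieszMap_sub_le_three_mul (h : IsPerturbation T₁ T₂ B)
    (hBs : IsSelfAdjoint B) (hc : IsCompactOperator (invOneAddSq T₁))
    (hB : ‖B * invSqrt T₁‖ ≤ 1 / 2) :
    ‖rieszMap T₂ - rieszMap T₁‖ ≤ 3 * ‖B * invSqrt T₁‖ := by
  have h1 := h.norm_rieszMap_sub_le hc
  have h2 := norm_mul_mul_sq_le (IsSelfAdjoint.of_nonneg (invFourthRoot_nonneg T₂))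
    (IsSelfAdjoint.of_nonneg (invFourthRoot_nonneg T₁)) hBs
  rw [invFourthRoot_mul_self, invFourthRoot_mul_self,
    norm_mul_comm_of_isSelfAdjoint (invSqrt_isSelfAdjoint T₂) hBs,
    norm_mul_comm_of_isSelfAdjoint (invSqrt_isSelfAdjoint T₁) hBs] at h2
  have h3 := h.norm_mul_invSqrt_le hB
  have h4 : ‖invFourthRoot T₂ * B * invFourthRoot T₁‖ ≤ 2 * ‖B * invSqrt T₁‖ := by
    refine le_of_sq_le_sq ?_ (by positivity)
    nlinarith [norm_nonneg (B * invSqrt T₁)]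
  linarith

/-- The resolvent identity exhibits (T₂ + i)⁻¹ as (T₁ + i)⁻¹ times a bounded operator. -/
theorem isCompactOperator_invOneAddSq_of_isPerturbation (h : IsPerturbation T₁ T₂ B)
    (hc : HasCompactResolvent T₁) : IsCompactOperator (invOneAddSq T₂) := by
  have h1 := h.symm.resolventOp_sub Complex.I I_im_ne
  have h2 : resolventOp T₂ Complex.I I_im_ne = resolventOp T₁ Complex.I I_im_ne *
      (1 + (-B) * resolventOp T₂ Complex.I I_im_ne) := by
    rw [mul_add, mul_one, ← mul_assoc, ← h1, add_sub_cancel]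
  have h3 : invOneAddSq T₂ = resolventOp T₁ Complex.I I_im_ne *
      ((1 + (-B) * resolventOp T₂ Complex.I I_im_ne) *
        resolventOp T₂ (-Complex.I) neg_I_im_ne) := by
    rw [← mul_assoc, ← h2]
    rfl
  rw [h3]
  exact IsCompactOperator.comp_clm hc _

theorem isCompactOperator_invOneAddSq {D : SelfAdjointOp H} (hD : HasCompactResolvent D) :
    IsCompactOperator (invOneAddSq D) :=
  IsCompactOperator.comp_clm hD _

/-! ### Comparison of topologies induced by metrics -/

theorem stronger_of_forall {X : Type*} {d₁ d₂ : X → X → ℝ}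
    (h : ∀ x, ∀ ε > 0, ∃ δ > 0, ∀ y, d₁ x y < δ → d₂ x y < ε) : Stronger d₁ d₂ := by
  intro U hU x hx
  obtain ⟨ε, hε, h1⟩ := hU x hx
  obtain ⟨δ, hδ, h2⟩ := h x ε hε
  exact ⟨δ, hδ, fun y hy => h1 y (h2 y hy)⟩

/-- The `d₁`-ball of radius ε around `x` is `d₁`-open by the triangle inequality, yet contains no
`d₂`-ball around `x`. -/
theorem strictlyStronger_of_forall {X : Type*} {d₁ d₂ : X → X → ℝ} (h : Stronger d₁ d₂)
    (htri : ∀ x y z, d₁ x z ≤ d₁ x y + d₁ y z) (x : X) (hx : d₁ x x = 0) {ε : ℝ} (hε : 0 < ε)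
    (hex : ∀ δ > 0, ∃ y, d₂ x y < δ ∧ ε ≤ d₁ x y) : StrictlyStronger d₁ d₂ := by
  refine lt_of_le_not_ge h fun h' => ?_
  have hopen : (metricTopology d₁).IsOpen {y | d₁ x y < ε} := by
    intro y hy
    refine ⟨ε - d₁ x y, sub_pos.mpr hy, fun z hz => ?_⟩
    have := htri x y z
    change d₁ x z < ε
    linarith
  obtain ⟨δ, hδ, h1⟩ := h' _ hopen x (by change d₁ x x < ε; rwa [hx])
  obtain ⟨y, hy1, hy2⟩ := hex δ hδ
  exact hy2.not_gt (h1 y hy1)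

theorem dW_eq (D : SelfAdjointOp H) (C₁ C₂ : BoundedSelfAdjointOp H) :
    dW D C₁ C₂ = ‖(C₁.1 - C₂.1) * invSqrt D‖ := by
  have h : ∀ C : BoundedSelfAdjointOp H,
      relBounded D ⟨addBounded D C, rfl⟩ = C.1 * invSqrt D + rieszMap D := fun C => rfl
  rw [dW, distFixedDomain, h, h, add_sub_add_right_eq_sub, sub_mul]

theorem dG_eq (D : SelfAdjointOp H) (C₁ C₂ : BoundedSelfAdjointOp H) :
    dG D C₁ C₂ = ‖resolventOp (addBounded D C₁) Complex.I I_im_ne -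
      resolventOp (addBounded D C₂) Complex.I I_im_ne‖ := distG_eq _ _

theorem stronger_dN_dW (D : SelfAdjointOp H) : Stronger (dN D) (dW D) := by
  refine stronger_of_forall fun C ε hε => ⟨ε, hε, fun C' h => lt_of_le_of_lt ?_ h⟩
  rw [dW_eq, dN]
  exact (norm_mul_le _ _).trans (mul_le_of_le_one_right (norm_nonneg _) (norm_invSqrt_le D))

/-- The metric d_W is measured with D, while the Riesz estimate at D + C needs (I + (D +
C)²)^(-1/2). Equality of the domains allows the change of weight, at a cost depending on C only. -/
theorem norm_mul_invSqrt_addBounded_le (D : SelfAdjointOp H) (C : BoundedSelfAdjointOp H)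
    (A : H →L[ℂ] H) :
    ‖A * invSqrt (addBounded D C)‖ ≤ (2 + ‖C.1‖) * ‖A * invSqrt D‖ := by
  refine ContinuousLinearMap.opNorm_le_bound _ (by positivity) fun y => ?_
  set T := addBounded D C
  have h1 := invSqrt_of_mem_graph D
    ((addBounded_mem_graph D C).mp (invSqrt_rieszMap_mem_graph T y))
  set z := invSqrt D (invSqrt T y) + rieszMap D (rieszMap T y - C.1 (invSqrt T y))
  have h2 : ‖z‖ ≤ (2 + ‖C.1‖) * ‖y‖ := by
    have a1 := norm_invSqrt_apply_le D (invSqrt T y)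
    have a2 := norm_invSqrt_apply_le T y
    have a3 := norm_rieszMap_apply_le D (rieszMap T y - C.1 (invSqrt T y))
    have a4 := norm_rieszMap_apply_le T y
    have a5 := norm_sub_le (rieszMap T y) (C.1 (invSqrt T y))
    have a6 : ‖C.1 (invSqrt T y)‖ ≤ ‖C.1‖ * ‖y‖ := (C.1.le_opNorm _).trans (by gcongr)
    have a7 := norm_add_le (invSqrt D (invSqrt T y))
      (rieszMap D (rieszMap T y - C.1 (invSqrt T y)))
    linarith
  have h3 : (A * invSqrt T) y = (A * invSqrt D) z := congrArg A h1.symm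
  rw [h3]
  calc _ ≤ ‖A * invSqrt D‖ * ‖z‖ := (A * invSqrt D).le_opNorm z
    _ ≤ ‖A * invSqrt D‖ * ((2 + ‖C.1‖) * ‖y‖) := by gcongr
    _ = _ := by ring

theorem exists_forall_dW_lt_dR_lt {D : SelfAdjointOp H} (hD : HasCompactResolvent D)
    (C : BoundedSelfAdjointOp H) (ε : ℝ) (hε : 0 < ε) :
    ∃ δ > 0, ∀ C', dW D C C' < δ → dR D C C' < ε := by
  have hK0 : 0 < 2 + ‖C.1‖ := by positivity
  refine ⟨min (1 / 2) (ε / 3) / (2 + ‖C.1‖), by positivity, fun C' h => ?_⟩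
  rw [dW_eq, ← norm_neg, ← neg_mul, neg_sub, lt_div_iff₀ hK0, mul_comm] at h
  have h1 := (norm_mul_invSqrt_addBounded_le D C (C'.1 - C.1)).trans_lt h
  have h2 := (isPerturbation_addBounded D C C').norm_rieszMap_sub_le_three_mul (C'.2.sub C.2)
    (isCompactOperator_invOneAddSq_of_isPerturbation (isPerturbation_self_addBounded D C) hD)
    (h1.le.trans (min_le_left _ _))
  rw [norm_sub_rev] at h2
  have h3 := h1.trans_le (min_le_right _ _)
  rw [dR, distR]
  linarith

theorem stronger_dW_dR {D : SelfAdjointOp H} (hD : HasCompactResolvent D) :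
    Stronger (dW D) (dR D) :=
  stronger_of_forall (exists_forall_dW_lt_dR_lt hD)

end

/-! ### The resolvent as a continuous function of the bounded transform -/

theorem exists_forall_dR_lt_dG_lt (D : SelfAdjointOp H) (C : BoundedSelfAdjointOp H) (ε : ℝ)
    (hε : 0 < ε) : ∃ δ > 0, ∀ C', dR D C C' < δ → dG D C C' < ε := by
  have hF : ∀ T : SelfAdjointOp H, (1 - rieszMap T * rieszMap T : H →L[ℂ] H) = invOneAddSq T := by
    intro T
    rw [rieszMap_mul_self, sub_sub_cancel, invSqrt_mul_self]
  let Φ : (H →L[ℂ] H) → (H →L[ℂ] H) := fun A =>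
    A * CFC.sqrt (1 - A * A) - Complex.I • (1 - A * A)
  have hΦ : ∀ T : SelfAdjointOp H, resolventOp T Complex.I I_im_ne = Φ (rieszMap T) := by
    intro T
    change _ = rieszMap T * CFC.sqrt (1 - rieszMap T * rieszMap T) - _
    rw [resolventOp_I_eq, hF]
    rfl
  let s : Set (H →L[ℂ] H) := {A | 0 ≤ 1 - A * A}
  have hs : ∀ T : SelfAdjointOp H, rieszMap T ∈ s := fun T => by
    change 0 ≤ 1 - rieszMap T * rieszMap T
    rw [hF]
    exact invOneAddSq_nonneg T
  -- The square root is norm continuous on positive operators; this is only continuity at each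
  -- point, so δ may depend on `C`.
  have hcont : ContinuousOn Φ s := by
    have h1 : ContinuousOn (fun A : H →L[ℂ] H => CFC.sqrt (1 - A * A)) s :=
      CFC.continuousOn_sqrt.comp (f := fun A : H →L[ℂ] H => 1 - A * A) (by fun_prop)
        (fun A hA => hA)
    exact (continuousOn_id.mul h1).sub (by fun_prop)
  obtain ⟨δ, hδ, h⟩ := Metric.continuousOn_iff.mp hcont _ (hs (addBounded D C)) ε hε
  refine ⟨δ, hδ, fun C' h' => ?_⟩
  have h1 := h _ (hs (addBounded D C')) (by rw [dist_comm, dist_eq_norm]; exact h')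
  rwa [dist_comm, dist_eq_norm, ← hΦ, ← hΦ, ← dG_eq] at h1

theorem stronger_dR_dG (D : SelfAdjointOp H) : Stronger (dR D) (dG D) :=
  stronger_of_forall (exists_forall_dR_lt_dG_lt D)

/-! ### The set of conjugation-bounded perturbations -/

/-- Substituting x = |D + i|⁻¹z removes the unbounded factor. -/
theorem ConjNormLE.norm_le {D : SelfAdjointOp H} {R : ℝ} {C : BoundedSelfAdjointOp H}
    (h : ConjNormLE D R C) (z : H) : ‖invSqrt D (C.1 z)‖ ≤ R * ‖invSqrt D z‖ := by
  obtain ⟨hm, e⟩ := absAddI_invSqrt D z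
  have h1 := h ⟨invSqrt D z, hm⟩
  have h2 : conjByAbs D C ⟨invSqrt D z, hm⟩ =
      invSqrt D (C.1 (absAddI D ⟨invSqrt D z, hm⟩)) := rfl
  rwa [h2, e] at h1

theorem inner_resolventOp (T : SelfAdjointOp H) (x y : H) :
    ⟪resolventOp T Complex.I I_im_ne x, y⟫_ℂ = ⟪x, resolventOp T (-Complex.I) neg_I_im_ne y⟫_ℂ := by
  have h := inner_graph T (resolventOp_mem_graph T Complex.I I_im_ne x)
    (resolventOp_mem_graph T (-Complex.I) neg_I_im_ne y)
  rw [inner_sub_left, inner_sub_right, inner_smul_left, inner_smul_right, Complex.conj_I] at h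
  linear_combination -h

/-- `(I + D²)^(-1/2) y = (D + C + z)⁻¹ w` with a bound for `w`, for `z = ± i`. -/
theorem ConjNormLE.exists_resolventOp_eq {D : SelfAdjointOp H} {R : ℝ}
    {C : BoundedSelfAdjointOp H} (hR : 0 ≤ R) (h : ConjNormLE D R C) (z : ℂ) (hz : z.im ≠ 0)
    (hz1 : ‖z‖ = 1) (y : H) :
    ∃ w, resolventOp (addBounded D C) z hz w = invSqrt D y ∧ ‖w‖ ≤ (2 + R) * ‖y‖ := by
  have h1 := (isPerturbation_self_addBounded D C _ _).mp (invSqrt_rieszMap_mem_graph D y)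
  refine ⟨_, resolventOp_of_mem_graph _ z hz h1, ?_⟩
  have h2 : ‖invSqrt D * C.1‖ ≤ R := by
    refine ContinuousLinearMap.opNorm_le_bound _ hR fun x => (h.norm_le x).trans ?_
    gcongr
    exact norm_invSqrt_apply_le D x
  rw [norm_mul_comm_of_isSelfAdjoint (invSqrt_isSelfAdjoint D) C.2] at h2
  have h3 : ‖C.1 (invSqrt D y)‖ ≤ R * ‖y‖ := (C.1 * invSqrt D).le_of_opNorm_le h2 y
  have h4 := norm_add_le (z • invSqrt D y) (rieszMap D y + C.1 (invSqrt D y))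
  have h5 := norm_add_le (rieszMap D y) (C.1 (invSqrt D y))
  have h6 := norm_rieszMap_apply_le D y
  have h7 := norm_invSqrt_apply_le D y
  rw [norm_smul, hz1, one_mul] at h4
  linarith

/-- Writing Sx = (D + C + i)⁻¹v and Sy = (D + C' - i)⁻¹w turns ⟪SBSx, y⟫ into ⟪(D + C' + i)⁻¹B(D + C
+ i)⁻¹v, w⟫, a matrix element of the resolvent difference. Each of v, w costs a factor 2 + R. -/
theorem norm_invSqrt_mul_mul_le {D : SelfAdjointOp H} {R : ℝ} (hR : 0 ≤ R)
    {C C' : BoundedSelfAdjointOp H} (h : ConjNormLE D R C) (h' : ConjNormLE D R C') :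
    ‖invSqrt D * (C'.1 - C.1) * invSqrt D‖ ≤ (2 + R) ^ 2 * dG D C C' := by
  have hd : 0 ≤ dG D C C' := by rw [dG_eq]; positivity
  have hbil : ∀ x y, ‖⟪(invSqrt D * (C'.1 - C.1) * invSqrt D) x, y⟫_ℂ‖ ≤
      (2 + R) ^ 2 * dG D C C' * ‖x‖ * ‖y‖ := by
    intro x y
    obtain ⟨v, hv, hvx⟩ := h.exists_resolventOp_eq hR Complex.I I_im_ne (by simp) x
    obtain ⟨w, hw, hwy⟩ := h'.exists_resolventOp_eq hR (-Complex.I) neg_I_im_ne (by simp) y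
    have e : ⟪(invSqrt D * (C'.1 - C.1) * invSqrt D) x, y⟫_ℂ =
        ⟪(resolventOp (addBounded D C) Complex.I I_im_ne -
          resolventOp (addBounded D C') Complex.I I_im_ne) v, w⟫_ℂ := by
      rw [(isPerturbation_addBounded D C C').resolventOp_sub]
      change ⟪invSqrt D ((C'.1 - C.1) (invSqrt D x)), y⟫_ℂ = ⟪resolventOp (addBounded D C')
        Complex.I I_im_ne ((C'.1 - C.1) (resolventOp (addBounded D C) Complex.I I_im_ne v)), w⟫_ℂ
      rw [inner_invSqrt, inner_resolventOp, hv, hw]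
    rw [e]
    calc _ ≤ (dG D C C' * ‖v‖) * ‖w‖ := by
          refine (norm_inner_le_norm _ _).trans ?_
          gcongr
          rw [dG_eq]
          exact ContinuousLinearMap.le_opNorm _ _
      _ ≤ (dG D C C' * ((2 + R) * ‖x‖)) * ((2 + R) * ‖y‖) := by gcongr
      _ = _ := by ring
  refine ContinuousLinearMap.opNorm_le_bound _ (by positivity) fun x => ?_
  have h1 := hbil x ((invSqrt D * (C'.1 - C.1) * invSqrt D) x)
  rw [inner_self_ofReal, Complex.norm_real, Real.norm_of_nonneg (by positivity), sq] at h1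
  rcases (norm_nonneg ((invSqrt D * (C'.1 - C.1) * invSqrt D) x)).eq_or_lt with h0 | h0
  · rw [← h0]; positivity
  · exact le_of_mul_le_mul_right h1 h0

/-- On conjugation-bounded perturbations, `d_W` is controlled by the graph metric. -/
theorem dW_le_of_conjNormLE {D : SelfAdjointOp H} {R : ℝ} (hR : 0 ≤ R)
    {C C' : BoundedSelfAdjointOp H} (h : ConjNormLE D R C) (h' : ConjNormLE D R C') {η : ℝ}
    (hη : 0 < η) : dW D C C' ≤ 2 * R * η + (2 + R) ^ 2 * dG D C C' * η⁻¹ := by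
  have hd : 0 ≤ dG D C C' := by rw [dG_eq]; positivity
  rw [dW_eq, ← norm_neg, ← neg_mul, neg_sub,
    norm_mul_comm_of_isSelfAdjoint (C'.2.sub C.2) (invSqrt_isSelfAdjoint D)]
  -- Split SB = SBSW + ηSBW. The first term is small with d_G; in the second, ‖SBWx‖ ≤ 2R‖SWx‖ ≤
  -- 2R‖x‖, which avoids ‖W‖ ≤ η⁻¹.
  obtain ⟨W, e1, -, hW, hSW⟩ := exists_inv_add_scalar (invSqrt_nonneg D) hη
  refine ContinuousLinearMap.opNorm_le_bound _ (by positivity) fun x => ?_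
  have h1 : x = invSqrt D (W x) + (η : ℂ) • W x :=
    (congrArg (fun A : H →L[ℂ] H => A x) e1).symm
  set B := C'.1 - C.1 with hB
  have h2 : (invSqrt D * B) x =
      (invSqrt D * B * invSqrt D) (W x) + (η : ℂ) • invSqrt D (B (W x)) := by
    conv_lhs => rw [h1]
    simp
  have h3 : ‖invSqrt D (B (W x))‖ ≤ 2 * R * ‖x‖ := by
    have a1 := h.norm_le (W x)
    have a2 := h'.norm_le (W x)
    have a3 := norm_sub_le (invSqrt D (C'.1 (W x))) (invSqrt D (C.1 (W x)))
    have a4 : ‖invSqrt D (W x)‖ ≤ 1 * ‖x‖ := (invSqrt D * W).le_of_opNorm_le hSW x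
    have a5 : invSqrt D (B (W x)) = invSqrt D (C'.1 (W x)) - invSqrt D (C.1 (W x)) := by
      simp [hB]
    rw [a5]
    nlinarith
  have h4 : ‖(invSqrt D * B * invSqrt D) (W x)‖ ≤ (2 + R) ^ 2 * dG D C C' * (η⁻¹ * ‖x‖) :=
    (ContinuousLinearMap.le_of_opNorm_le _ (norm_invSqrt_mul_mul_le hR h h') _).trans
      (by gcongr; exact W.le_of_opNorm_le hW x)
  rw [h2]
  refine (norm_add_le _ _).trans ?_
  rw [norm_smul, Complex.norm_real, Real.norm_of_nonneg hη.le]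
  nlinarith

theorem stronger_dR_dW_conjBounded (D : SelfAdjointOp H) {R : ℝ} (hR : 0 ≤ R) :
    Stronger (fun C₁ C₂ : ConjBounded D R => dR D C₁.1 C₂.1)
      (fun C₁ C₂ : ConjBounded D R => dW D C₁.1 C₂.1) := by
  refine stronger_of_forall fun C ε hε => ?_
  -- This makes 2Rη ≤ ε/2; using R + 1 covers R = 0.
  set η := ε / (4 * (R + 1)) with hηd
  have hη : 0 < η := by positivity
  obtain ⟨δ, hδ, h⟩ := exists_forall_dR_lt_dG_lt D C.1 (ε / 2 * η / (2 + R) ^ 2) (by positivity)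
  refine ⟨δ, hδ, fun C' hC' => ?_⟩
  have h1 := h C'.1 hC'
  refine (dW_le_of_conjNormLE hR C.2 C'.2 hη).trans_lt ?_
  have h2 : (2 + R) ^ 2 * dG D C.1 C'.1 * η⁻¹ < ε / 2 := by
    rw [lt_div_iff₀ (by positivity)] at h1
    rw [← div_eq_mul_inv, div_lt_iff₀ hη]
    linarith
  have h3 : 2 * R * η ≤ ε / 2 := by
    have : 2 * R * η = ε / 2 * (R / (R + 1)) := by rw [hηd]; field_simp; ring
    rw [this]
    exact mul_le_of_le_one_right (by positivity) (div_le_one_of_le₀ (by linarith) (by positivity))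
  linarith

/-! ### Eigenvectors of operators with compact resolvent -/

/-- A compact, injective, positive operator on an infinite-dimensional space has arbitrarily small
eigenvalues. -/
theorem exists_small_eigenvalue {A : H →L[ℂ] H} (hA : 0 ≤ A) (hc : IsCompactOperator A)
    (hi : Function.Injective A) (hinf : ¬ FiniteDimensional ℂ H) {ε : ℝ} (hε : 0 < ε) :
    ∃ a : ℝ, 0 < a ∧ a < ε ∧ ∃ e : H, e ≠ 0 ∧ A e = (a : ℂ) • e := by
  by_contra! hno
  -- A spectral gap above 0 makes t ↦ 1/max(t, ε) invert t on the nonzero spectrum, so AWA = A.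
  -- Injectivity gives WA = 1, and a compact identity forces finite dimension.
  have hs : ∀ t ∈ spectrum ℝ A, t = 0 ∨ ε ≤ t := by
    intro t ht
    rcases (spectrum_nonneg_of_nonneg hA ht).eq_or_lt with h0 | h0
    · exact Or.inl h0.symm
    right
    by_contra! hlt
    have h1 : (t : ℂ) ∈ spectrum ℂ A := spectrum.algebraMap_mem ℂ ht
    obtain ⟨e, he⟩ := ((hc.hasEigenvalue_iff_mem_spectrum
      (Complex.ofReal_ne_zero.mpr h0.ne')).mpr h1).exists_hasEigenvector
    exact hno t h0 hlt e he.2 he.apply_eq_smul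
  have hsa : IsSelfAdjoint A := IsSelfAdjoint.of_nonneg hA
  have hg : Continuous fun t : ℝ => (max t ε)⁻¹ :=
    (continuous_id.max continuous_const).inv₀ fun t => (lt_max_of_lt_right hε).ne'
  set W := cfc (fun t : ℝ => (max t ε)⁻¹) A with hW
  have h1 : A * (W * A) = A := by
    have e1 : W * A = cfc (fun t : ℝ => (max t ε)⁻¹ * t) A := by
      rw [cfc_mul (fun t : ℝ => (max t ε)⁻¹) (fun t => t) A hg.continuousOn continuousOn_id,
        cfc_id' ℝ A]
    have e2 : A * (W * A) = cfc (fun t : ℝ => t * ((max t ε)⁻¹ * t)) A := by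
      rw [cfc_mul (fun t : ℝ => t) (fun t => (max t ε)⁻¹ * t) A continuousOn_id
        (hg.mul continuous_id).continuousOn, cfc_id' ℝ A, e1]
    rw [e2]
    conv_rhs => rw [← cfc_id' ℝ A]
    refine cfc_congr fun t ht => ?_
    rcases hs t ht with h0 | h0
    · simp [h0]
    · simp only [max_eq_left h0]
      rw [inv_mul_cancel₀ (hε.trans_le h0).ne', mul_one]
  have h2 : W * A = 1 := by
    ext x
    exact hi (congrArg (fun B : H →L[ℂ] H => B x) h1)
  have h3 : IsCompactOperator (W * A) := hc.clm_comp W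
  rw [h2] at h3
  exact hinf (FiniteDimensional.of_isCompactOperator_id h3)

theorem invOneAddSq_injective (T : SelfAdjointOp H) : Function.Injective (invOneAddSq T) := by
  intro x y h
  rw [← invSqrt_sq, ← invSqrt_sq] at h
  exact invSqrt_injective T (invSqrt_injective T h)

/-- A self-adjoint operator with compact resolvent in an infinite-dimensional space has eigenvalues
of arbitrarily large absolute value. -/
theorem exists_large_eigenvalue {D : SelfAdjointOp H} (hD : HasCompactResolvent D)
    (hinf : ¬ FiniteDimensional ℂ H) (M : ℝ) :
    ∃ (l : ℝ) (e : H), M < |l| ∧ ‖e‖ = 1 ∧ (e, (l : ℂ) • e) ∈ D.1.graph := by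
  suffices h : ∃ (l : ℝ) (e : H), M < |l| ∧ e ≠ 0 ∧ (e, (l : ℂ) • e) ∈ D.1.graph by
    obtain ⟨l, e, hl, he, hg⟩ := h
    refine ⟨l, ((‖e‖⁻¹ : ℝ) : ℂ) • e, hl, ?_, ?_⟩
    · rw [norm_smul, Complex.norm_real, norm_inv, norm_norm, inv_mul_cancel₀ (norm_ne_zero_iff.mpr he)]
    · rw [smul_comm]
      exact smul_mem_graph D _ hg
  obtain ⟨a, ha0, ha1, e, he, hae⟩ := exists_small_eigenvalue (invOneAddSq_nonneg D)
    (isCompactOperator_invOneAddSq hD) (invOneAddSq_injective D) hinf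
    (show 0 < (M ^ 2 + 1)⁻¹ by positivity)
  have hM : M ^ 2 < a⁻¹ - 1 := by
    have := (lt_inv_comm₀ ha0 (by positivity)).mp ha1
    linarith
  set l := Real.sqrt (a⁻¹ - 1) with hl
  have hl2 : l ^ 2 = a⁻¹ - 1 := Real.sq_sqrt (by nlinarith [sq_nonneg M])
  have hlM : M < |l| := lt_of_le_of_lt (le_abs_self M) (sq_lt_sq.mp (by rw [hl2]; exact hM))
  obtain ⟨y, g1, g2⟩ : ∃ y, (invOneAddSq D e, y) ∈ D.1.graph ∧
      (y, e - invOneAddSq D e) ∈ D.1.graph := by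
    obtain ⟨h, h', e1⟩ := invOneAddSq_spec D e
    refine ⟨_, LinearPMap.mem_graph D.1 ⟨_, h⟩, ?_⟩
    have g2 := LinearPMap.mem_graph D.1 ⟨_, h'⟩
    rwa [eq_sub_of_add_eq' e1] at g2
  rw [hae] at g1 g2
  have hac : (a : ℂ) ≠ 0 := by exact_mod_cast ha0.ne'
  have g3 : (e, (a : ℂ)⁻¹ • y) ∈ D.1.graph := by
    have := smul_mem_graph D (a : ℂ)⁻¹ g1
    rwa [smul_smul, inv_mul_cancel₀ hac, one_smul] at this
  have g4 : ((a : ℂ)⁻¹ • y, ((l ^ 2 : ℝ) : ℂ) • e) ∈ D.1.graph := by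
    have := smul_mem_graph D (a : ℂ)⁻¹ g2
    rw [smul_sub, smul_smul, inv_mul_cancel₀ hac, ← sub_smul] at this
    rw [hl2]
    push_cast
    exact this
  set v := (a : ℂ)⁻¹ • y
  -- Here v = De and D²e = l²e, so (D - l)(D + l)e = 0: either e has eigenvalue -l, or (D + l)e is
  -- an eigenvector for l.
  by_cases hu : v + (l : ℂ) • e = 0
  · refine ⟨-l, e, by rwa [abs_neg], he, ?_⟩
    rw [eq_neg_of_add_eq_zero_left hu] at g3
    rw [Complex.ofReal_neg, neg_smul]
    exact g3
  · refine ⟨l, v + (l : ℂ) • e, hlM, hu, ?_⟩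
    have := add_mem_graph D g4 (smul_mem_graph D (l : ℂ) g3)
    convert this using 2
    push_cast
    module

theorem rieszMap_eigenvector (T : SelfAdjointOp H) {l : ℝ} {e : H}
    (h : (e, (l : ℂ) • e) ∈ T.1.graph) : rieszMap T e = (l : ℂ) • invSqrt T e := by
  rw [rieszMap_of_mem_graph T h, map_smul]

theorem invSqrt_eigenvector (T : SelfAdjointOp H) {l : ℝ} {e : H}
    (h : (e, (l : ℂ) • e) ∈ T.1.graph) :
    invSqrt T e = (((Real.sqrt (1 + l ^ 2))⁻¹ : ℝ) : ℂ) • e := by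
  set s := (Real.sqrt (1 + l ^ 2))⁻¹ with hs
  have hs0 : 0 < s := by positivity
  have hs2 : s ^ 2 * (1 + l ^ 2) = 1 := by
    rw [hs, inv_pow, Real.sq_sqrt (by positivity), inv_mul_cancel₀ (by positivity)]
  have h1 : ((1 + l ^ 2 : ℝ) : ℂ) • invSqrt T (invSqrt T e) = e := by
    conv_rhs => rw [← rieszMap_sq_add T e]
    rw [rieszMap_eigenvector T h, map_smul, ← invSqrt_rieszMap, rieszMap_eigenvector T h, map_smul,
      smul_smul]
    push_cast
    module
  have h2 : invSqrt T (invSqrt T e) = ((s ^ 2 : ℝ) : ℂ) • e := by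
    conv_rhs => rw [← h1]
    rw [smul_smul, ← Complex.ofReal_mul, hs2, Complex.ofReal_one, one_smul]
  -- From S²e = s²e comes (S + s)v = 0, and S + s is strictly positive, so v = 0.
  set v := invSqrt T e - (s : ℂ) • e with hv
  have h3 : invSqrt T v + (s : ℂ) • v = 0 := by
    rw [hv, map_sub, h2, map_smul]
    push_cast
    module
  have h4 : ((‖invFourthRoot T v‖ ^ 2 + s * ‖v‖ ^ 2 : ℝ) : ℂ) = 0 := by
    have h5 : ⟪invSqrt T v + (s : ℂ) • v, v⟫_ℂ = 0 := by rw [h3, inner_zero_left]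
    rw [inner_add_left, inner_smul_left, Complex.conj_ofReal, inner_self_ofReal,
      ← invFourthRoot_mul_self] at h5
    have h6 : ⟪(invFourthRoot T * invFourthRoot T) v, v⟫_ℂ =
        ⟪invFourthRoot T v, invFourthRoot T v⟫_ℂ := inner_nonneg_op (invFourthRoot_nonneg T) _ _
    rw [h6, inner_self_ofReal] at h5
    exact_mod_cast h5
  have h7 : ‖invFourthRoot T v‖ ^ 2 + s * ‖v‖ ^ 2 = 0 := by exact_mod_cast h4
  have h8 : ‖v‖ ^ 2 = 0 := by nlinarith [sq_nonneg ‖invFourthRoot T v‖, sq_nonneg ‖v‖]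
  exact sub_eq_zero.mp (norm_eq_zero.mp (pow_eq_zero_iff two_ne_zero |>.mp h8))

theorem norm_invSqrt_eigenvector_le (T : SelfAdjointOp H) {l : ℝ} {e : H} (he : ‖e‖ = 1)
    (hl : l ≠ 0) (h : (e, (l : ℂ) • e) ∈ T.1.graph) : ‖invSqrt T e‖ ≤ |l|⁻¹ := by
  have hl0 : 0 < |l| := abs_pos.mpr hl
  rw [invSqrt_eigenvector T h, norm_smul, he, mul_one, Complex.norm_real,
    Real.norm_of_nonneg (by positivity)]
  refine inv_anti₀ hl0 (Real.le_sqrt_of_sq_le ?_)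
  rw [sq_abs]
  linarith

/-! ### Strictness -/

variable (H) in
/-- The zero operator, as a bounded self-adjoint operator. -/
def zeroOp : BoundedSelfAdjointOp H := ⟨0, IsSelfAdjoint.zero _⟩

theorem addBounded_zeroOp (D : SelfAdjointOp H) : addBounded D (zeroOp H) = D := by
  refine Subtype.ext (LinearPMap.eq_of_eq_graph ?_)
  ext ⟨x, y⟩
  rw [addBounded_mem_graph, zeroOp, zero_apply, sub_zero]

theorem zeroOp_sub (C : BoundedSelfAdjointOp H) : (zeroOp H).1 - C.1 = -C.1 := zero_sub _

theorem strictlyStronger_dN_dW {D : SelfAdjointOp H} (hD : HasCompactResolvent D)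
    (hinf : ¬ FiniteDimensional ℂ H) : StrictlyStronger (dN D) (dW D) := by
  refine strictlyStronger_of_forall (stronger_dN_dW D)
    (fun C₁ C₂ C₃ => norm_sub_le_norm_sub_add_norm_sub _ _ _) (zeroOp H) (by simp [dN]) one_pos
    fun δ hδ => ?_
  obtain ⟨l, f, hl, hf, hg⟩ := exists_large_eigenvalue hD hinf δ⁻¹
  have hl0 : 0 < |l| := (inv_pos.mpr hδ).trans hl
  set C : BoundedSelfAdjointOp H := ⟨InnerProductSpace.rankOne ℂ f f, by
    rw [ContinuousLinearMap.isSelfAdjoint_iff', InnerProductSpace.adjoint_rankOne]⟩ with hC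
  have hC1 : C.1 = InnerProductSpace.rankOne ℂ f f := rfl
  refine ⟨C, ?_, ?_⟩
  · have h1 : ‖invSqrt D * C.1‖ ≤ |l|⁻¹ := by
      have : invSqrt D * C.1 = InnerProductSpace.rankOne ℂ (invSqrt D f) f :=
        InnerProductSpace.comp_rankOne _ _ _
      rw [this, InnerProductSpace.norm_rankOne, hf, mul_one]
      exact norm_invSqrt_eigenvector_le D hf (abs_pos.mp hl0) hg
    rw [norm_mul_comm_of_isSelfAdjoint (invSqrt_isSelfAdjoint D) C.2] at h1
    rw [dW_eq, zeroOp_sub, neg_mul, norm_neg]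
    exact h1.trans_lt (inv_lt_of_inv_lt₀ hδ hl)
  · rw [dN, zeroOp_sub, norm_neg, hC1, InnerProductSpace.norm_rankOne, hf, mul_one]

theorem strictlyStronger_dR_dG {D : SelfAdjointOp H} (hD : HasCompactResolvent D)
    (hinf : ¬ FiniteDimensional ℂ H) : StrictlyStronger (dR D) (dG D) := by
  refine strictlyStronger_of_forall (stronger_dR_dG D)
    (fun C₁ C₂ C₃ => norm_sub_le_norm_sub_add_norm_sub _ _ _) (zeroOp H) (by simp [dR, distR]) one_pos
    fun δ hδ => ?_
  -- The perturbation -2l⟪e, ·⟫e flips the eigenvalue l to -l. The bound |l| > 1 gives 2|l|/(1 +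
  -- l²)^(1/2) ≥ 1 for the Riesz distance, and |l| > 2/δ gives 2/|l| < δ for the graph distance.
  obtain ⟨l, e, hl, he, hg⟩ := exists_large_eigenvalue hD hinf (max 1 (2 / δ))
  have hl1 : 1 < |l| := (le_max_left _ _).trans_lt hl
  have hl2 : 2 / δ < |l| := (le_max_right _ _).trans_lt hl
  have hl0 : 0 < |l| := one_pos.trans hl1
  set C : BoundedSelfAdjointOp H := ⟨((-2 * l : ℝ) : ℂ) • InnerProductSpace.rankOne ℂ e e, by
    rw [ContinuousLinearMap.isSelfAdjoint_iff', map_smulₛₗ, InnerProductSpace.adjoint_rankOne,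
      Complex.conj_ofReal]⟩ with hC
  have hCx : ∀ x, C.1 x = ((-2 * l : ℝ) : ℂ) • ⟪e, x⟫_ℂ • e := fun x => rfl
  set T := addBounded D C with hT
  have hgT : (e, ((-l : ℝ) : ℂ) • e) ∈ T.1.graph := by
    rw [hT, addBounded_mem_graph, hCx, inner_self_ofReal, he]
    convert hg using 2
    push_cast
    module
  have hne : ∀ t : ℝ, |t| ≤ ‖Complex.I + (t : ℂ)‖ := fun t => by
    simpa using Complex.abs_re_le_norm (Complex.I + (t : ℂ))
  have hnl : 0 < ‖Complex.I + (l : ℂ)‖ := hl0.trans_le (hne l)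
  have hnl' : 0 < ‖Complex.I + ((-l : ℝ) : ℂ)‖ :=
    hl0.trans_le (by simpa only [abs_neg] using hne (-l))
  have hRT : resolventOp T Complex.I I_im_ne e = (Complex.I + ((-l : ℝ) : ℂ))⁻¹ • e := by
    have h1 := resolventOp_of_mem_graph T Complex.I I_im_ne hgT
    rw [← add_smul, map_smul] at h1
    rw [eq_inv_smul_iff₀ (norm_pos_iff.mp hnl'), h1]
  have hRD : ∀ x, ⟪e, resolventOp D Complex.I I_im_ne x⟫_ℂ = (Complex.I + (l : ℂ))⁻¹ * ⟪e, x⟫_ℂ := by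
    intro x
    have h1 := inner_graph D hg (resolventOp_mem_graph D Complex.I I_im_ne x)
    rw [inner_smul_left, Complex.conj_ofReal, inner_sub_right, inner_smul_right] at h1
    rw [eq_inv_mul_iff_mul_eq₀ (norm_pos_iff.mp hnl)]
    linear_combination h1
  refine ⟨C, ?_, ?_⟩
  · rw [dG_eq, addBounded_zeroOp, (isPerturbation_self_addBounded D C).resolventOp_sub]
    have hb : ‖resolventOp T Complex.I I_im_ne * C.1 * resolventOp D Complex.I I_im_ne‖ ≤
        2 / |l| := by
      refine ContinuousLinearMap.opNorm_le_bound _ (by positivity) fun x => ?_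
      have h1 : (resolventOp T Complex.I I_im_ne * C.1 * resolventOp D Complex.I I_im_ne) x =
          ((-2 * l : ℝ) : ℂ) • ((Complex.I + (l : ℂ))⁻¹ * ⟪e, x⟫_ℂ) •
            (Complex.I + ((-l : ℝ) : ℂ))⁻¹ • e := by
        change resolventOp T Complex.I I_im_ne (C.1 (resolventOp D Complex.I I_im_ne x)) = _
        rw [hCx, map_smul, map_smul, hRD, hRT]
      have h2 : ‖⟪e, x⟫_ℂ‖ ≤ ‖x‖ := by simpa [he] using norm_inner_le_norm (𝕜 := ℂ) e x
      have h3 := inv_anti₀ hl0 (hne l)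
      have h4 : ‖Complex.I + ((-l : ℝ) : ℂ)‖⁻¹ ≤ |l|⁻¹ :=
        inv_anti₀ hl0 (by simpa only [abs_neg] using hne (-l))
      rw [h1, norm_smul, norm_smul, norm_smul, norm_mul, norm_inv, norm_inv, he, mul_one,
        Complex.norm_real, Real.norm_eq_abs, abs_mul, abs_neg, abs_two]
      calc _ ≤ 2 * |l| * (|l|⁻¹ * ‖x‖ * |l|⁻¹) := by gcongr
        _ = _ := by field_simp
    exact hb.trans_lt (by rwa [div_lt_comm₀ hl0 hδ])
  · rw [dR, distR, addBounded_zeroOp]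
    have h1 := ContinuousLinearMap.le_opNorm (rieszMap D - rieszMap T) e
    rw [he, mul_one] at h1
    refine le_trans ?_ h1
    rw [sub_apply, rieszMap_eigenvector D hg, rieszMap_eigenvector T hgT, invSqrt_eigenvector D hg,
      invSqrt_eigenvector T hgT, neg_sq]
    set s := (Real.sqrt (1 + l ^ 2))⁻¹ with hs
    have h2 : (l : ℂ) • (s : ℂ) • e - ((-l : ℝ) : ℂ) • (s : ℂ) • e = ((2 * l * s : ℝ) : ℂ) • e := by
      push_cast
      module
    rw [h2, norm_smul, he, mul_one, Complex.norm_real, Real.norm_eq_abs, abs_mul, abs_mul, abs_two,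
      hs, abs_inv, abs_of_nonneg (Real.sqrt_nonneg _), ← div_eq_mul_inv,
      one_le_div (by positivity), Real.sqrt_le_left (by positivity)]
    rw [mul_pow, sq_abs]
    have : 1 < l ^ 2 := by rw [← sq_abs]; nlinarith
    linarith

/-- The self-adjoint operator `x ↦ c (⟪f, x⟫ e + ⟪e, x⟫ f)`. -/
noncomputable def symmRankTwo (c : ℝ) (e f : H) : BoundedSelfAdjointOp H :=
  ⟨(c : ℂ) • (InnerProductSpace.rankOne ℂ e f + InnerProductSpace.rankOne ℂ f e), by
    rw [ContinuousLinearMap.isSelfAdjoint_iff', map_smulₛₗ, map_add,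
      InnerProductSpace.adjoint_rankOne, InnerProductSpace.adjoint_rankOne, Complex.conj_ofReal,
      add_comm]⟩

theorem symmRankTwo_apply (c : ℝ) (e f x : H) :
    (symmRankTwo c e f).1 x = (c : ℂ) • (⟪f, x⟫_ℂ • e + ⟪e, x⟫_ℂ • f) := rfl

theorem norm_symmRankTwo_le {c : ℝ} (hc : 0 ≤ c) {e f : H} (he : ‖e‖ = 1) (hf : ‖f‖ = 1) :
    ‖(symmRankTwo c e f).1‖ ≤ 2 * c := by
  have h1 := norm_add_le (InnerProductSpace.rankOne ℂ e f) (InnerProductSpace.rankOne ℂ f e)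
  rw [InnerProductSpace.norm_rankOne, InnerProductSpace.norm_rankOne, he, hf] at h1
  rw [symmRankTwo, norm_smul, Complex.norm_real, Real.norm_of_nonneg hc]
  nlinarith

theorem norm_mul_symmRankTwo_mul_le {c : ℝ} (hc : 0 ≤ c) (e f : H) (p : H →L[ℂ] H)
    {q : H →L[ℂ] H} (hq : 0 ≤ q) :
    ‖p * (symmRankTwo c e f).1 * q‖ ≤ c * (‖p e‖ * ‖q f‖ + ‖p f‖ * ‖q e‖) := by
  refine ContinuousLinearMap.opNorm_le_bound _ (by positivity) fun x => ?_
  have h1 : (p * (symmRankTwo c e f).1 * q) x =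
      (c : ℂ) • (⟪q f, x⟫_ℂ • p e + ⟪q e, x⟫_ℂ • p f) := by
    change p ((symmRankTwo c e f).1 (q x)) = _
    rw [symmRankTwo_apply, map_smul, map_add, map_smul, map_smul, inner_nonneg_op hq,
      inner_nonneg_op hq]
  rw [h1, norm_smul, Complex.norm_real, Real.norm_of_nonneg hc, mul_assoc]
  gcongr
  refine (norm_add_le _ _).trans ?_
  rw [norm_smul, norm_smul]
  have h2 := norm_inner_le_norm (𝕜 := ℂ) (q f) x
  have h3 := norm_inner_le_norm (𝕜 := ℂ) (q e) x
  calc _ ≤ ‖q f‖ * ‖x‖ * ‖p e‖ + ‖q e‖ * ‖x‖ * ‖p f‖ := by gcongr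
    _ = _ := by ring

/-- By duality: ‖S₂f‖² = ⟪f, S₂(S₂f)⟫ = ⟪S₁f, z⟫ with S₁z = S₂(S₂f) and ‖z‖ ≤ 4‖S₂f‖. -/
theorem IsPerturbation.norm_invSqrt_apply_le {T₁ T₂ : SelfAdjointOp H} {B : H →L[ℂ] H}
    (h : IsPerturbation T₁ T₂ B) (hB : ‖B * invSqrt T₁‖ ≤ 1 / 2) (f : H) :
    ‖invSqrt T₂ f‖ ≤ 4 * ‖invSqrt T₁ f‖ := by
  obtain ⟨z, hz, hzy⟩ := h.exists_invSqrt_eq hB (invSqrt T₂ f)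
  have h1 : ⟪invSqrt T₂ f, invSqrt T₂ f⟫_ℂ = ⟪invSqrt T₁ f, z⟫_ℂ := by
    rw [inner_invSqrt T₂ f, ← hz, inner_invSqrt]
  have h2 := norm_inner_le_norm (𝕜 := ℂ) (invSqrt T₁ f) z
  rw [← h1, inner_self_ofReal, Complex.norm_real, Real.norm_of_nonneg (by positivity)] at h2
  rcases (norm_nonneg (invSqrt T₂ f)).eq_or_lt with h0 | h0
  · rw [← h0]; positivity
  · refine le_of_mul_le_mul_right ?_ h0
    nlinarith [norm_nonneg (invSqrt T₁ f)]

theorem strictlyStronger_dW_dR {D : SelfAdjointOp H} (hD : HasCompactResolvent D)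
    (hinf : ¬ FiniteDimensional ℂ H) : StrictlyStronger (dW D) (dR D) := by
  have : Nontrivial H := by
    by_contra h
    rw [not_nontrivial_iff_subsingleton] at h
    exact hinf inferInstance
  obtain ⟨e, he⟩ := exists_norm_eq H zero_le_one
  have hSe : 0 < ‖invSqrt D e‖ := by
    rw [norm_pos_iff, ← map_zero (invSqrt D)]
    refine fun h => ?_
    rw [invSqrt_injective D h, norm_zero] at he
    exact zero_ne_one he
  refine strictlyStronger_of_forall (stronger_dW_dR hD)
    (fun C₁ C₂ C₃ => norm_sub_le_norm_sub_add_norm_sub _ _ _) (zeroOp H) (by simp [dW_eq])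
    (ε := ‖invSqrt D e‖ / 16) (by positivity) fun δ hδ => ?_
  -- The first bound gives ‖SCf‖ ≥ (‖Se‖ - m)/8 ≥ ‖Se‖/16. The second controls the fourth roots at
  -- f, whose squared norms are at most ‖Sf‖ ≤ m for D and 4m for D + C.
  set m := min (‖invSqrt D e‖ / 2) (δ ^ 2 / 2) with hm
  have hm0 : 0 < m := by positivity
  obtain ⟨l, f, hl, hf, hg⟩ := exists_large_eigenvalue hD hinf m⁻¹
  have hl0 : 0 < |l| := (inv_pos.mpr hm0).trans hl
  have hSf : ‖invSqrt D f‖ ≤ m := (norm_invSqrt_eigenvector_le D hf (abs_pos.mp hl0) hg).trans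
    (inv_lt_of_inv_lt₀ hm0 hl).le
  have hm1 : m ≤ ‖invSqrt D e‖ / 2 := min_le_left _ _
  have hm2 : m ≤ δ ^ 2 / 2 := min_le_right _ _
  -- The factor 1/8 yields ‖C‖ ≤ 1/4, within the smallness condition, and the Riesz distance is at
  -- most (3/2)(1/8)(3δ) < δ.
  set C := symmRankTwo (1 / 8) e f with hC
  refine ⟨C, ?_, ?_⟩
  · set T := addBounded D C
    have hp : IsPerturbation D T C.1 := isPerturbation_self_addBounded D C
    have hCn : ‖C.1 * invSqrt D‖ ≤ 1 / 2 := by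
      have h1 := norm_symmRankTwo_le (c := 1 / 8) (by norm_num) he hf
      have h2 := (norm_mul_le C.1 (invSqrt D)).trans
        (mul_le_of_le_one_right (norm_nonneg _) (norm_invSqrt_le D))
      linarith
    have h1 := hp.norm_rieszMap_sub_le (isCompactOperator_invOneAddSq hD)
    have h2 := norm_mul_symmRankTwo_mul_le (c := 1 / 8) (by norm_num) e f (invFourthRoot T)
      (invFourthRoot_nonneg D)
    have h3 := hp.norm_invSqrt_apply_le hCn f
    have hpe : ‖invFourthRoot T e‖ ≤ 1 := by
      have a1 := norm_invFourthRoot_apply_sq_le T e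
      have a2 := UnboundedOp.norm_invSqrt_apply_le T e
      rw [he] at a1 a2
      exact le_of_sq_le_sq (by linarith) zero_le_one
    have hqe : ‖invFourthRoot D e‖ ≤ 1 := by
      have a1 := norm_invFourthRoot_apply_sq_le D e
      have a2 := UnboundedOp.norm_invSqrt_apply_le D e
      rw [he] at a1 a2
      exact le_of_sq_le_sq (by linarith) zero_le_one
    have hqf : ‖invFourthRoot D f‖ ≤ δ := by
      have a1 := norm_invFourthRoot_apply_sq_le D f
      rw [hf] at a1
      exact le_of_sq_le_sq (by nlinarith) hδ.le
    have hpf : ‖invFourthRoot T f‖ ≤ 2 * δ := by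
      have a1 := norm_invFourthRoot_apply_sq_le T f
      rw [hf] at a1
      exact le_of_sq_le_sq (by nlinarith) (by positivity)
    have h4 : ‖invFourthRoot T e‖ * ‖invFourthRoot D f‖ +
        ‖invFourthRoot T f‖ * ‖invFourthRoot D e‖ ≤ 1 * δ + 2 * δ * 1 := by gcongr
    rw [dR, distR, addBounded_zeroOp, norm_sub_rev]
    linarith
  · rw [dW_eq, zeroOp_sub, neg_mul, norm_neg,
      norm_mul_comm_of_isSelfAdjoint C.2 (invSqrt_isSelfAdjoint D)]
    have h1 := (invSqrt D * C.1).le_opNorm f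
    rw [hf, mul_one] at h1
    refine le_trans ?_ h1
    have h2 : (invSqrt D * C.1) f =
        ((1 / 8 : ℝ) : ℂ) • (invSqrt D e + ⟪e, f⟫_ℂ • invSqrt D f) := by
      change invSqrt D (C.1 f) = _
      rw [hC, symmRankTwo_apply, inner_self_ofReal, hf, map_smul, map_add, map_smul, map_smul]
      simp
    rw [h2, norm_smul, Complex.norm_real, Real.norm_of_nonneg (by norm_num)]
    have h3 : ‖⟪e, f⟫_ℂ • invSqrt D f‖ ≤ m := by
      rw [norm_smul]
      have a1 := norm_inner_le_norm (𝕜 := ℂ) e f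
      rw [he, hf] at a1
      nlinarith [norm_nonneg (invSqrt D f)]
    have h4 := norm_sub_le_norm_add (invSqrt D e) (⟪e, f⟫_ℂ • invSqrt D f)
    linarith

end UnboundedOp

open UnboundedOp
theorem propositionS1p2 {H : Type*} [NormedAddCommGroup H] [InnerProductSpace ℂ H]
    [CompleteSpace H] [TopologicalSpace.SeparableSpace H]
    (D : SelfAdjointOp H) (hD : HasCompactResolvent D) :
    (¬ FiniteDimensional ℂ H →
      StrictlyStronger (dN D) (dW D) ∧
      StrictlyStronger (dW D) (dR D) ∧
      StrictlyStronger (dR D) (dG D)) ∧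
    (∀ R : ℝ, 0 ≤ R →
      Stronger (fun C₁ C₂ : ConjBounded D R => dW D C₁.1 C₂.1)
        (fun C₁ C₂ : ConjBounded D R => dR D C₁.1 C₂.1) ∧
      Stronger (fun C₁ C₂ : ConjBounded D R => dR D C₁.1 C₂.1)
        (fun C₁ C₂ : ConjBounded D R => dW D C₁.1 C₂.1)) := by
  refine ⟨fun hinf => ⟨strictlyStronger_dN_dW hD hinf, strictlyStronger_dW_dR hD hinf,
    strictlyStronger_dR_dG hD hinf⟩, fun R hR => ⟨?_, stronger_dR_dW_conjBounded D hR⟩⟩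
  -- The comparison of d_W with d_R holds around each point of the full space, so it restricts to
  -- the subset.
  refine stronger_of_forall fun C ε hε => ?_
  obtain ⟨δ, hδ, h⟩ := exists_forall_dW_lt_dR_lt hD C.1 ε hε
  exact ⟨δ, hδ, fun C' => h C'.1⟩
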